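/- **Formula for mir in the standard case.** *Standard coefficients.* Let $\beta(\tau)=\dfrac{1}{e^{\tau/2}-e^{-\tau/2}}=\sum_{k\ge -1}\beta_k\tau^k$ and $\beta^*_k(\tau)=\beta(\partial_\tau)\,\tau^k=\sum_{s=-1}^{k}\beta_s\,\frac{k!}{(k-s)!}\,\tau^{k-s}$. *The transform nir.* Let $f(x)=\sum_{k\ge\kappa}f_kx^k\in\mathbb{C}[[x]]$ with $\kappa\ge 0$ and $f_\kappa\ne 0$, and fix a determination $\omega$ of $f_\kappa^{1/(\kappa+1)}$ (the main one if $\Re f_\kappa>0$; any other is allowed). Put $$f^{\uparrow\beta^*}(n,\tau)=\sum_{k\ge\kappa}f_k\,n^{-k}\beta_k^*(\tau)-f_\kappa\frac{n^{-\kappa}\tau^{\kappa+1}}{\kappa+1}.$$ Then $h=\mathrm{nir}(f)$ is the formal series in powers of $\nu^{1/(\kappa+1)}$ given by $$h(\nu)=\frac1{2\pi i}\int_{c-i\infty}^{c+i\infty}e^{n\nu}\frac{dn}{n}\int_0^\infty\exp\Big(-f_\kappa\frac{n^{-\kappa}\tau^{\kappa+1}}{\kappa+1}\Big)\exp_\#\big(-f^{\uparrow\beta^*}(n,\tau)\big)\,d\tau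 ,$$ where $\exp_\#(X)$ means the exponential expanded as a power series in $X$, and where both integrations are carried out term by term through $$\int_0^\infty e^{-f_\kappa n^{-\kappa}\tau^{\kappa+1}/(\kappa+1)}\tau^p\,d\tau=\omega^{-(p+1)}(\kappa+1)^{\frac{p+1}{\kappa+1}-1}\,\Gamma\Big(\frac{p+1}{\kappa+1}\Big)\,n^{\frac{\kappa(p+1)}{\kappa+1}},\qquad \frac1{2\pi i}\int_{c-i\infty}^{c+i\infty} e^{n\nu}n^{-q}\frac{dn}{n}=\frac{\nu^q}{\Gamma(q+1)} .$$ *The transform mir.* Let $f^*(x)=\int_0^xf$, let $g^*(\nu)=(\kappa+1)^{1/(\kappa+1)}\omega^{-1}\nu^{1/(\kappa+1)}+\cdots$ be its formal reciprocal, $f^*\circ g^*=\mathrm{id}$, and let $g=\partial_\nu g^*$, $\bar g=1/g$, $h=\mathrm{nir}(f)$, $\hbar=1/h$. The transform mir is the map $\bar g\mapsto\hbar$. *Claim.* For every pair $\bar g\mapsto\hbar$ of this kind, $\hbar\neq0$ and $$\frac1{\hbar(\nu)}=\Big[\frac1{\bar g(\nu)}\exp_\#\Big(-\sum_{r\ge1}\beta_r\,I^r\,(\bar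 g(\nu)\partial_\nu)^r\,\bar g(\nu)\Big)\Big]_{I=\partial_\nu^{-1}} .$$ The right-hand side is read as follows. Expand the blocks $(\bar g\partial_\nu)^r\bar g$; with $I$ a formal variable commuting with everything, expand $\frac1{\bar g}\exp_\#(\cdots)=\sum_{r\ge0}I^rA_r(\nu)$; then replace $I^rA_r$ by the $r$-fold iterated integral of $A_r$ from $0$ to $\nu$. Every $A_r$ contains only exponents $>-1$ of $\nu$, so that these integrations from $0$ make sense, and the resulting series $\sum_{r\ge0}\partial_\nu^{-r}A_r$ is formally summable: its exponents lie in one well-ordered set and each power of $\nu$ receives only finitely many contributions. -/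

import Mathlib

namespace Mir

open scoped Polynomial PowerSeries

/-! ### Ramified power series in `ν` -/

/-- Formal series `∑ a_q ν^q` with complex coefficients and rational exponents (well-ordered
support). All power series, Laurent series and Puiseux series in `ν` live in this field. -/
abbrev RamSeries : Type := HahnSeries ℚ ℂ

/-- Formal derivation `∂_ν`, with `∂_ν ν^q = q ν^(q-1)`. -/
noncomputable def dNu (a : RamSeries) : RamSeries where
  coeff q := ((q + 1 : ℚ) : ℂ) * a.coeff (q + 1)
  isPWO_support' := by
    refine (a.isPWO_support.image_of_monotone (f := fun q : ℚ => q - 1)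
      (fun x y h => by simpa using h)).mono ?_
    intro q hq
    refine ⟨q + 1, ?_, by simp⟩
    intro h0
    exact hq (by simp [h0])

/-- Formal integration from `0`, `I = ∂_ν⁻¹`, with `I ν^q = ν^(q+1) / (q+1)`; it is the integral
from `0` to `ν` of series all of whose exponents are `> -1`. -/
noncomputable def intNu (a : RamSeries) : RamSeries where
  coeff q := a.coeff (q - 1) / (q : ℂ)
  isPWO_support' := by
    refine (a.isPWO_support.image_of_monotone (f := fun q : ℚ => q + 1)
      (fun x y h => by simpa using h)).mono ?_
    intro q hq
    refine ⟨q - 1, ?_, by simp⟩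
    intro h0
    exact hq (by simp [h0])

/-! ### The standard coefficients and polynomials -/

/-- The Laurent series of `β(τ) = 1 / (e^(τ/2) - e^(-τ/2))`. -/
noncomputable def betaSeries : LaurentSeries ℂ :=
  (((PowerSeries.rescale (1 / 2 : ℂ) (PowerSeries.exp ℂ) -
    PowerSeries.rescale (-1 / 2 : ℂ) (PowerSeries.exp ℂ) : ℂ⟦X⟧)) : LaurentSeries ℂ)⁻¹

/-- The Euler–Bernoulli coefficients: `β(τ) = ∑_{k ≥ -1} β_k τ^k`. -/
noncomputable def beta (k : ℤ) : ℂ := betaSeries.coeff k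

/-- The Euler–Bernoulli polynomials
`β*_k(τ) = β(∂_τ) τ^k = ∑_{s=-1}^{k} β_s τ^(k-s) k! / (k-s)!`; the index `j` is `s + 1`. -/
noncomputable def betaStar (k : ℕ) : ℂ[X] :=
  ∑ j ∈ Finset.range (k + 2),
    Polynomial.C (beta ((j : ℤ) - 1) * (k.factorial : ℂ) / ((k + 1 - j).factorial : ℂ)) *
      Polynomial.X ^ (k + 1 - j)

/-- The expanded exponential `exp_#(u) = ∑_s u^s / s!` of a power series `u` without constant
term, as a power series in the same variable. -/
noncomputable def expSharp {R : Type*} [CommRing R] [Algebra ℚ R] (u : R⟦X⟧) : R⟦X⟧ :=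
  (PowerSeries.exp R).subst u

/-! ### The transform `nir` -/

/-- The tangency order `κ` of `f(x) = ∑_{k ≥ κ} f_k x^k`, `f_κ ≠ 0`. -/
noncomputable def tangency (f : ℂ⟦X⟧) : ℕ := f.order.toNat

/-- `f^{⇑β*}(n, τ) = β(∂_τ) f(τ/n) = ∑_k f_k n^(-k) β*_k(τ)`, as a power series in `n⁻¹` whose
coefficients are polynomials in `τ`. -/
noncomputable def fUpFull (f : ℂ⟦X⟧) : ℂ[X]⟦X⟧ :=
  PowerSeries.mk fun k => Polynomial.C (PowerSeries.coeff k f) * betaStar k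

/-- `f^{↑β*}(n, τ)`: the series `f^{⇑β*}(n, τ)` minus its leading term
`f_κ n^(-κ) τ^(κ+1) / (κ+1)`. -/
noncomputable def fUp (f : ℂ⟦X⟧) : ℂ[X]⟦X⟧ :=
  fUpFull f - PowerSeries.monomial (tangency f)
    (Polynomial.C (PowerSeries.coeff (tangency f) f / ((tangency f : ℂ) + 1)) *
      Polynomial.X ^ (tangency f + 1))

/-- The constant `f_κ^(-(p+1)/(κ+1)) (κ+1)^((p+1)/(κ+1)-1) Γ((p+1)/(κ+1))` in
`∫_0^∞ exp(-f_κ n^(-κ) τ^(κ+1)/(κ+1)) τ^p dτ = (constant) n^(κ(p+1)/(κ+1))`,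
where `ω` is the chosen determination of `f_κ^(1/(κ+1))`. -/
noncomputable def laplaceConst (κ : ℕ) (ω : ℂ) (p : ℕ) : ℂ :=
  (ω ^ (p + 1))⁻¹ *
    ((((κ : ℝ) + 1) ^ (((p : ℝ) + 1) / ((κ : ℝ) + 1) - 1) *
      Real.Gamma (((p : ℝ) + 1) / ((κ : ℝ) + 1)) : ℝ) : ℂ)

/-- The exponent `q = N - κ(p+1)/(κ+1)`: the `τ`-integration turns `n^(-N) τ^p` into a multiple
of `n^(-q)`. -/
def nirExponent (κ N p : ℕ) : ℚ := (N : ℚ) - (κ : ℚ) * ((p : ℚ) + 1) / ((κ : ℚ) + 1)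

/-- The contribution to `nir(f)` of the monomial `n^(-N) τ^p` of `exp_#(-f^{↑β*}(n, τ))`:
ramified Laplace integration in `τ`, followed by the upper Borel integration
`n^(-q) ↦ ν^q / q!`, `q! = Γ(q+1)`. -/
noncomputable def nirTerm (ω : ℂ) (f : ℂ⟦X⟧) (i : ℕ × ℕ) : RamSeries :=
  HahnSeries.single (nirExponent (tangency f) i.1 i.2)
    ((PowerSeries.coeff i.1 (expSharp (-fUp f))).coeff i.2 * laplaceConst (tangency f) ω i.2 /
      ((Real.Gamma ((nirExponent (tangency f) i.1 i.2 : ℝ) + 1) : ℝ) : ℂ))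

theorem beta_neg_one_zero : beta (-1) = 1 ∧ beta 0 = 0 := by
  set S : ℂ⟦X⟧ := PowerSeries.rescale (1 / 2 : ℂ) (PowerSeries.exp ℂ) -
    PowerSeries.rescale (-1 / 2 : ℂ) (PowerSeries.exp ℂ) with hS
  set U : ℂ⟦X⟧ := PowerSeries.mk fun n => PowerSeries.coeff (n + 1) S with hU
  have h0 : PowerSeries.coeff 0 S = 0 := by
    rw [hS, map_sub, PowerSeries.coeff_rescale, PowerSeries.coeff_rescale]
    simp
  have hSU : S = PowerSeries.X * U := by
    ext n
    cases n with
    | zero => rw [h0]; simp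
    | succ n => rw [PowerSeries.coeff_succ_X_mul, hU, PowerSeries.coeff_mk]
  have hU0 : PowerSeries.constantCoeff U = 1 := by
    rw [← PowerSeries.coeff_zero_eq_constantCoeff_apply, hU, PowerSeries.coeff_mk]
    simp [hS, PowerSeries.coeff_rescale, PowerSeries.coeff_exp]
    norm_num
  have hU1 : PowerSeries.coeff 1 U = 0 := by
    rw [hU, PowerSeries.coeff_mk]
    simp [hS, PowerSeries.coeff_rescale, PowerSeries.coeff_exp]
    norm_num
  have hUV : U * U⁻¹ = 1 := PowerSeries.mul_inv_cancel U (by rw [hU0]; exact one_ne_zero)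
  have hb : betaSeries = HahnSeries.single (-1 : ℤ) (1 : ℂ) * ((U⁻¹ : ℂ⟦X⟧) : LaurentSeries ℂ) := by
    unfold betaSeries
    rw [← hS]
    refine inv_eq_of_mul_eq_one_right ?_
    have h1 : (S : LaurentSeries ℂ) = HahnSeries.single (1 : ℤ) (1 : ℂ) * (U : LaurentSeries ℂ) := by
      rw [hSU, PowerSeries.coe_mul, PowerSeries.coe_X]
    rw [h1, mul_mul_mul_comm, HahnSeries.single_mul_single, ← PowerSeries.coe_mul, hUV]
    simp
  have hV0 : PowerSeries.coeff 0 U⁻¹ = 1 := by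
    rw [PowerSeries.coeff_inv]; simp [hU0]
  have hV1 : PowerSeries.coeff 1 U⁻¹ = 0 := by
    rw [PowerSeries.coeff_inv]
    simp [hU0, hU1, Finset.Nat.antidiagonal_succ]
  have key : ∀ n : ℕ, betaSeries.coeff ((n : ℤ) - 1) = PowerSeries.coeff n U⁻¹ := by
    intro n
    have := HahnSeries.coeff_single_mul_add (r := (1 : ℂ))
      (x := ((U⁻¹ : ℂ⟦X⟧) : LaurentSeries ℂ)) (a := (n : ℤ)) (b := (-1 : ℤ))
    rw [hb, sub_eq_add_neg, this, one_mul]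
    exact LaurentSeries.coeff_coe_powerSeries _ _
  refine ⟨?_, ?_⟩
  · have := key 0
    rw [hV0] at this
    simpa [beta] using this
  · have := key 1
    rw [hV1] at this
    simpa [beta] using this

/-- Only monomials `n^(-N) τ^p` with `(κ+1) p ≤ (κ+2) N` occur in `u`. -/
def SlopeLE (κ : ℕ) (u : ℂ[X]⟦X⟧) : Prop :=
  ∀ N p : ℕ, (PowerSeries.coeff N u).coeff p ≠ 0 → (κ + 1) * p ≤ (κ + 2) * N

theorem SlopeLE.one (κ : ℕ) : SlopeLE κ 1 := by
  intro N p h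
  rw [PowerSeries.coeff_one] at h
  split_ifs at h with hN
  · rw [Polynomial.coeff_one] at h
    split_ifs at h with hp
    · subst hp; simp
    · exact absurd rfl h
  · simp at h

theorem SlopeLE.mul {κ : ℕ} {u v : ℂ[X]⟦X⟧} (hu : SlopeLE κ u) (hv : SlopeLE κ v) :
    SlopeLE κ (u * v) := by
  intro N p h
  rw [PowerSeries.coeff_mul, Polynomial.finsetSum_coeff] at h
  obtain ⟨⟨a, b⟩, hab, h⟩ := Finset.exists_ne_zero_of_sum_ne_zero h
  rw [Polynomial.coeff_mul] at h
  obtain ⟨⟨c, d⟩, hcd, h⟩ := Finset.exists_ne_zero_of_sum_ne_zero h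
  have h1 := hu a c (left_ne_zero_of_mul h)
  have h2 := hv b d (right_ne_zero_of_mul h)
  rw [Finset.HasAntidiagonal.mem_antidiagonal] at hab hcd
  simp only at hab hcd
  rw [← hab, ← hcd]
  nlinarith

theorem SlopeLE.pow {κ : ℕ} {u : ℂ[X]⟦X⟧} (hu : SlopeLE κ u) (d : ℕ) : SlopeLE κ (u ^ d) := by
  induction d with
  | zero => rw [pow_zero]; exact SlopeLE.one κ
  | succ d ih => rw [pow_succ]; exact ih.mul hu

theorem SlopeLE.constantCoeff {κ : ℕ} {u : ℂ[X]⟦X⟧} (hu : SlopeLE κ u)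
    (h0 : (PowerSeries.coeff 0 u).coeff 0 = 0) : PowerSeries.constantCoeff u = 0 := by
  rw [← PowerSeries.coeff_zero_eq_constantCoeff_apply]
  ext p
  rw [Polynomial.coeff_zero]
  by_contra h
  have := hu 0 p h
  have hp : p = 0 := by
    by_contra hp
    have : 0 < (κ + 1) * p := by positivity
    omega
  exact h (by rw [hp, h0])

theorem SlopeLE.expSharp {κ : ℕ} {u : ℂ[X]⟦X⟧} (hu : SlopeLE κ u)
    (h0 : PowerSeries.constantCoeff u = 0) : SlopeLE κ (expSharp u) := by
  intro N p h
  by_contra hlt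
  refine h ?_
  have hz : ∀ d, (PowerSeries.coeff N (u ^ d)).coeff p = 0 := by
    intro d
    by_contra hne
    exact hlt (hu.pow d N p hne)
  have hs := PowerSeries.HasSubst.of_constantCoeff_zero' h0
  unfold Mir.expSharp
  rw [PowerSeries.coeff_subst' hs, finsum_eq_sum _ (PowerSeries.coeff_subst_finite' hs _ N),
    Polynomial.finsetSum_coeff]
  refine Finset.sum_eq_zero fun d _ => ?_
  rw [PowerSeries.coeff_exp, algebraMap_smul]
  simp [hz d]

theorem betaStar_coeff (k p : ℕ) (h : (betaStar k).coeff p ≠ 0) :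
    p = k + 1 ∨ p + 1 ≤ k := by
  unfold betaStar at h
  rw [Polynomial.finsetSum_coeff] at h
  obtain ⟨j, hj, h⟩ := Finset.exists_ne_zero_of_sum_ne_zero h
  rw [Polynomial.coeff_C_mul_X_pow] at h
  split_ifs at h with hp
  · rcases Nat.lt_or_ge j 2 with h2 | h2
    · interval_cases j
      · left; omega
      · exfalso
        apply h
        simp [beta_neg_one_zero.2]
    · right
      rw [Finset.mem_range] at hj
      omega
  · exact absurd rfl h

theorem betaStar_coeff_top (k : ℕ) : (betaStar k).coeff (k + 1) = 1 / ((k : ℂ) + 1) := by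
  unfold betaStar
  rw [Polynomial.finsetSum_coeff, Finset.sum_eq_single 0]
  · rw [Polynomial.coeff_C_mul_X_pow]
    have : (k.factorial : ℂ) ≠ 0 := by exact_mod_cast k.factorial_ne_zero
    have h2 : (k : ℂ) + 1 ≠ 0 := by exact_mod_cast k.succ_ne_zero
    simp [beta_neg_one_zero.1, Nat.factorial_succ]
    field_simp
  · intro j _ hj
    rw [Polynomial.coeff_C_mul_X_pow, if_neg (by omega)]
  · simp

theorem slopeLE_neg_fUp (f : ℂ⟦X⟧) : SlopeLE (tangency f) (-fUp f) := by
  intro N p h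
  rw [map_neg, Polynomial.coeff_neg, neg_ne_zero] at h
  unfold fUp fUpFull at h
  rw [map_sub, PowerSeries.coeff_mk, PowerSeries.coeff_monomial, Polynomial.coeff_sub,
    Polynomial.coeff_C_mul] at h
  have hlow : N < tangency f → PowerSeries.coeff N f = 0 := by
    intro hN
    refine PowerSeries.coeff_of_lt_order N ?_
    by_contra hle
    exact absurd (ENat.toNat_le_of_le_natCast (not_lt.1 hle)) (not_le.2 hN)
  set κ := tangency f
  rcases lt_trichotomy N κ with hN | hN | hN
  · exact absurd (by simp [hlow hN, hN.ne]) h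
  · subst hN
    rw [if_pos rfl, Polynomial.coeff_C_mul_X_pow] at h
    split_ifs at h with hp
    · exfalso
      apply h
      rw [hp, betaStar_coeff_top]
      ring
    · rw [sub_zero] at h
      rcases betaStar_coeff _ _ (right_ne_zero_of_mul h) with h1 | h1
      · exact absurd h1 hp
      · nlinarith
  · rw [if_neg hN.ne', Polynomial.coeff_zero, sub_zero] at h
    rcases betaStar_coeff _ _ (right_ne_zero_of_mul h) with h1 | h1 <;> nlinarith

theorem constantCoeff_neg_fUp (f : ℂ⟦X⟧) : PowerSeries.constantCoeff (-fUp f) = 0 := by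
  refine (slopeLE_neg_fUp f).constantCoeff ?_
  have hb : (betaStar 0).coeff 0 = 0 := by
    by_contra h
    rcases betaStar_coeff _ _ h with h | h <;> omega
  unfold fUp fUpFull
  rw [map_neg, map_sub, PowerSeries.coeff_mk, PowerSeries.coeff_monomial, Polynomial.coeff_neg,
    Polynomial.coeff_sub, Polynomial.coeff_C_mul, hb]
  split_ifs <;> simp

theorem nirTerm_bounds (ω : ℂ) (f : ℂ⟦X⟧) (N p : ℕ) (q : ℚ)
    (h : (nirTerm ω f (N, p)).coeff q ≠ 0) :
    (tangency f + 1) * p ≤ (tangency f + 2) * N ∧ q = nirExponent (tangency f) N p := by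
  unfold nirTerm at h
  rw [HahnSeries.coeff_single] at h
  split_ifs at h with hq
  · refine ⟨?_, hq⟩
    refine (slopeLE_neg_fUp f).expSharp (constantCoeff_neg_fUp f) N p ?_
    intro h0
    simp [h0] at h
  · exact absurd rfl h

theorem nirExponent_eq (κ N p : ℕ) (h : (κ + 1) * p ≤ (κ + 2) * N) :
    ∃ w : ℕ, nirExponent κ N p = ((w : ℚ) - κ) / (κ + 1) ∧ N ≤ (κ + 1) * w := by
  have hk : κ * p ≤ (κ + 1) * N := by
    by_contra hlt
    have h1 : (κ + 1) * N + 1 ≤ κ * p := by omega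
    nlinarith
  refine ⟨(κ + 1) * N - κ * p, ?_, ?_⟩
  · have : (κ : ℚ) + 1 ≠ 0 := by positivity
    unfold nirExponent
    push_cast [Nat.cast_sub hk]
    field_simp
    ring
  · obtain ⟨w, hw⟩ := Nat.exists_eq_add_of_le hk
    rw [hw, Nat.add_sub_cancel_left]
    nlinarith

/-- The family of all contributions to `nir(f)`; each power of `ν` receives finitely many. -/
noncomputable def nirFamily (ω : ℂ) (f : ℂ⟦X⟧) : HahnSeries.SummableFamily ℚ ℂ (ℕ × ℕ) where
  toFun := nirTerm ω f
  isPWO_iUnion_support' := by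
    have hmono : Monotone fun w : ℕ => ((w : ℚ) - tangency f) / (tangency f + 1) := by
      intro a b hab
      have : (a : ℚ) ≤ b := by exact_mod_cast hab
      simp only
      gcongr
    refine ((Set.IsWF.of_wellFoundedLT (Set.univ : Set ℕ)).isPWO.image_of_monotone hmono).mono ?_
    intro q hq
    obtain ⟨⟨N, p⟩, hq⟩ := Set.mem_iUnion.1 hq
    obtain ⟨h1, h2⟩ := nirTerm_bounds ω f N p q hq
    obtain ⟨w, hw, _⟩ := nirExponent_eq _ _ _ h1
    exact ⟨w, Set.mem_univ _, by rw [h2, hw]⟩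
  finite_co_support' q := by
    obtain ⟨M, hM⟩ := exists_nat_ge ((q * (tangency f + 1) + tangency f) * (tangency f + 1))
    refine ((Set.finite_Iic M).prod (Set.finite_Iic (2 * M))).subset ?_
    rintro ⟨N, p⟩ h
    obtain ⟨h1, h2⟩ := nirTerm_bounds ω f N p q h
    obtain ⟨w, hw, hN⟩ := nirExponent_eq _ _ _ h1
    have hpos : (tangency f : ℚ) + 1 ≠ 0 := by positivity
    have hwq : (w : ℚ) = q * (tangency f + 1) + tangency f := by
      rw [h2, hw]; field_simp; ring
    have hNM : N ≤ M := by
      have : (N : ℚ) ≤ M := by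
        refine le_trans ?_ hM
        rw [← hwq]
        have : (N : ℚ) ≤ ((tangency f + 1) * w : ℕ) := by exact_mod_cast hN
        push_cast at this
        linarith
      exact_mod_cast this
    refine ⟨hNM, ?_⟩
    have : p ≤ 2 * N := by nlinarith
    simp only [Set.mem_Iic]
    omega

/-- The transform `nir : f ↦ h`, that is the double integral
`h(ν) = (1/2πi) ∫ e^(nν) dn/n ∫_0^∞ exp(-f_κ n^(-κ) τ^(κ+1)/(κ+1)) exp_#(-f^{↑β*}(n, τ)) dτ`
carried out term by term; `ω` is the chosen determination of `f_κ^(1/(κ+1))`. -/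
noncomputable def nir (ω : ℂ) (f : ℂ⟦X⟧) : RamSeries := (nirFamily ω f).hsum

/-! ### The transform `mir` -/

/-- `f*(x) = ∫_0^x f(t) dt`. -/
noncomputable def primitive (f : ℂ⟦X⟧) : ℂ⟦X⟧ :=
  PowerSeries.mk fun k => if k = 0 then 0 else PowerSeries.coeff (k - 1) f / (k : ℂ)

/-- The graph of the transform `mir`, which takes `ḡ` (`gbar`) to `ħ` (`hbar`). In the chain
`f ↦ f* = ∫_0 f ↦ g* = (f*)^{∘ -1} ↦ g = ∂_ν g* ↦ ḡ = 1/g ↦ ħ ↦ h = 1/ħ`, with `h = nir(f)`,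
it is the step from `ḡ` to `ħ`. The reciprocal
`g*(ν) = (κ+1)^(1/(κ+1)) f_κ^(-1/(κ+1)) ν^(1/(κ+1)) + …` and `nir(f)` are taken for the same
determination `ω` of `f_κ^(1/(κ+1))`. -/
def IsMir (gbar hbar : RamSeries) : Prop :=
  ∃ (f : ℂ⟦X⟧) (ω : ℂ) (gStar : RamSeries),
    f ≠ 0 ∧
    ω ^ (tangency f + 1) = PowerSeries.coeff (tangency f) f ∧
    0 < gStar.orderTop ∧
    PowerSeries.heval gStar (primitive f) = HahnSeries.single (1 : ℚ) (1 : ℂ) ∧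
    gStar.coeff (1 / ((tangency f : ℚ) + 1)) =
      ((((tangency f : ℝ) + 1) ^ (1 / ((tangency f : ℝ) + 1)) : ℝ) : ℂ) / ω ∧
    gbar = (dNu gStar)⁻¹ ∧
    hbar = (nir ω f)⁻¹

/-! ### The integro-differential expression -/

/-- The block `(ḡ ∂_ν)^r ḡ`. -/
noncomputable def block (gbar : RamSeries) (r : ℕ) : RamSeries :=
  (fun a => gbar * dNu a)^[r] gbar

/-- The expression `(1/ḡ) exp_#(-∑_{r ≥ 1} β_r I^r (ḡ ∂_ν)^r ḡ)`, expanded as a power series in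
the formal variable `I`. -/
noncomputable def bracket (gbar : RamSeries) : RamSeries⟦X⟧ :=
  PowerSeries.C gbar⁻¹ *
    expSharp (-PowerSeries.mk fun r => if r = 0 then 0 else beta (r : ℤ) • block gbar r)

end Mir

namespace Mir

open scoped Polynomial PowerSeries

/-! ### The expanded exponential -/

section ExpSharp

variable {R S : Type*} [CommRing R] [CommRing S]

/-! Put `I = n⁻¹` and `x = τ/n`, so that `∂_τ = I ∂_x`. Since `β_{-1} = 1` and `β_0 = 0`, the full
exponent of the integrand is `-n f*(x) - ∑_{r ≥ 1} β_r I^r f^{(r)}(x)` (`neg_fUp_eq`). The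
exponential therefore factors (`expSharp_neg_fUp`); its second factor expands as `∑ I^r P_r(x)`, and
a factor `I = n⁻¹` under the Borel integral is one integration in `ν` (`lam_X_pow_mul`). What
remains is the integral of `P_r(x) exp(-n f*(x)) n dx`. Heuristically the `n`-integration yields
`δ(ν - f*(x))`, whence the value `P_r(g*) ∂_ν g*` (`saddle_eq`).

On the other side `ḡ = f(g*)`, and `ḡ ∂_ν` acts on functions of `x = g*(ν)` as `∂_x`. Hence `(ḡ
∂_ν)^r ḡ = f^{(r)}(g*)` (`block_eq`), and the coefficient of `I^r` in the bracket is again `P_r(g*)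
∂_ν g*` (`coeff_bracket`).

The delta function is replaced by algebra. Both `F ↦ saddle F` and `F ↦ F(g*) ∂_ν g*` are linear,
turn multiplication by `f*` into multiplication by `ν` (`saddle_primitive_mul`), obey the same
integration by parts rule (`saddle_derivative`), and have the same leading coefficient on each `x^k`
(`saddle_lead`). These properties determine such a map. -/

theorem eq_of_forall_X_pow_dvd_sub {a b : R⟦X⟧}
    (h : ∀ M : ℕ, (PowerSeries.X : R⟦X⟧) ^ M ∣ a - b) : a = b := by
  rw [← sub_eq_zero]
  ext n
  exact PowerSeries.X_pow_dvd_iff.1 (h (n + 1)) n (Nat.lt_succ_self n)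

theorem X_pow_dvd_derivative (M : ℕ) (a : R⟦X⟧) (h : (PowerSeries.X : R⟦X⟧) ^ (M + 1) ∣ a) :
    PowerSeries.X ^ M ∣ PowerSeries.derivative R a := by
  rw [PowerSeries.X_pow_dvd_iff] at h ⊢
  intro n hn
  rw [PowerSeries.coeff_derivative, h (n + 1) (by omega), zero_mul]

theorem leibniz_pow_succ (D : R⟦X⟧ →+ R⟦X⟧) (hL : ∀ a b, D (a * b) = a * D b + b * D a)
    (u : R⟦X⟧) (m : ℕ) : D (u ^ (m + 1)) = ((m : R⟦X⟧) + 1) * u ^ m * D u := by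
  induction m with
  | zero => simp
  | succ m ih =>
    rw [pow_succ, hL, ih]
    push_cast
    ring

variable [Algebra ℚ R] [Algebra ℚ S]

/-- `expSharp u` agrees to order `M` with the partial sum of the exponential series. -/
theorem X_pow_dvd_expSharp_sub {u : R⟦X⟧} (hu : PowerSeries.constantCoeff u = 0) (M : ℕ) :
    (PowerSeries.X : R⟦X⟧) ^ M ∣
      expSharp u - ∑ m ∈ Finset.range M, (1 / (m.factorial : ℚ)) • u ^ m := by
  have hs := PowerSeries.HasSubst.of_constantCoeff_zero' hu
  have h1 : (PowerSeries.X : R⟦X⟧) ^ M ∣ PowerSeries.exp R -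
      ∑ m ∈ Finset.range M, PowerSeries.C (algebraMap ℚ R (1 / (m.factorial : ℚ))) *
        PowerSeries.X ^ m := by
    rw [PowerSeries.X_pow_dvd_iff]
    intro n hn
    rw [map_sub, map_sum, Finset.sum_eq_single n]
    · rw [PowerSeries.coeff_exp, PowerSeries.coeff_C_mul, PowerSeries.coeff_X_pow_self, mul_one,
        sub_self]
    · intro m _ hm
      rw [PowerSeries.coeff_C_mul, PowerSeries.coeff_X_pow, if_neg (Ne.symm hm), mul_zero]
    · intro h
      exact absurd (Finset.mem_range.2 hn) h
  obtain ⟨G, hG⟩ := h1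
  -- Substituting `u` turns the remainder `X ^ M * G` into a multiple of `u ^ M`, and `X ∣ u`.
  have h2 := congrArg (PowerSeries.substAlgHom (R := R) hs) hG
  rw [map_sub, map_mul, map_pow, map_sum] at h2
  simp only [PowerSeries.coe_substAlgHom, PowerSeries.subst_X hs] at h2
  have h3 : ∀ m : ℕ, PowerSeries.subst u
      (PowerSeries.C (algebraMap ℚ R (1 / (m.factorial : ℚ))) * PowerSeries.X ^ m : R⟦X⟧) =
      (1 / (m.factorial : ℚ)) • u ^ m := by
    intro m
    rw [← PowerSeries.smul_eq_C_mul, PowerSeries.subst_smul hs, PowerSeries.subst_pow hs,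
      PowerSeries.subst_X hs, algebraMap_smul]
  simp only [h3] at h2
  unfold expSharp
  rw [h2]
  exact Dvd.dvd.mul_right (pow_dvd_pow_of_dvd (PowerSeries.X_dvd_iff.2 hu) M) _

theorem constantCoeff_expSharp {u : R⟦X⟧} (hu : PowerSeries.constantCoeff u = 0) :
    PowerSeries.constantCoeff (expSharp u) = 1 := by
  have := X_pow_dvd_expSharp_sub hu 1
  rw [pow_one, PowerSeries.X_dvd_iff] at this
  simpa [sub_eq_zero] using this

/-- Ring homomorphisms which are continuous for the `X`-adic topology commute with `expSharp`. -/
theorem map_expSharp (φ : R⟦X⟧ →+* S⟦X⟧)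
    (hφ : (PowerSeries.X : S⟦X⟧) ∣ φ PowerSeries.X) {u : R⟦X⟧}
    (hu : PowerSeries.constantCoeff u = 0) : φ (expSharp u) = expSharp (φ u) := by
  have hu' : PowerSeries.constantCoeff (φ u) = 0 := by
    rw [← PowerSeries.X_dvd_iff]
    exact hφ.trans (map_dvd φ (PowerSeries.X_dvd_iff.2 hu))
  refine eq_of_forall_X_pow_dvd_sub fun M => ?_
  have h1 := map_dvd φ (X_pow_dvd_expSharp_sub hu M)
  rw [map_pow] at h1
  have h2 := (pow_dvd_pow_of_dvd hφ M).trans h1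
  have h3 := X_pow_dvd_expSharp_sub hu' M
  have h4 := dvd_sub h2 h3
  rw [map_sub, map_sum] at h4
  simp only [map_rat_smul, map_pow] at h4
  simpa using h4

/-- The chain rule for `expSharp`. -/
theorem derivation_expSharp (D : R⟦X⟧ →+ R⟦X⟧) (hL : ∀ a b, D (a * b) = a * D b + b * D a)
    (hD : ∀ (M : ℕ) (a : R⟦X⟧), (PowerSeries.X : R⟦X⟧) ^ (M + 1) ∣ a → PowerSeries.X ^ M ∣ D a)
    {u : R⟦X⟧} (hu : PowerSeries.constantCoeff u = 0) :
    D (expSharp u) = expSharp u * D u := by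
  refine eq_of_forall_X_pow_dvd_sub fun M => ?_
  -- One extra term is kept before applying `D`: `D` may lower the `X`-adic order by one, and it
  -- shifts the exponential sum by one index.
  have h1 := hD M _ (X_pow_dvd_expSharp_sub hu (M + 1))
  have h2 := (X_pow_dvd_expSharp_sub hu M).mul_right (D u)
  have hone : D 1 = 0 := by simpa using hL 1 1
  have h3 : D (∑ m ∈ Finset.range (M + 1), (1 / (m.factorial : ℚ)) • u ^ m) =
      (∑ m ∈ Finset.range M, (1 / (m.factorial : ℚ)) • u ^ m) * D u := by
    rw [map_sum, Finset.sum_range_succ', Finset.sum_mul]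
    simp only [map_rat_smul]
    rw [pow_zero, hone, smul_zero, add_zero]
    refine Finset.sum_congr rfl fun m _ => ?_
    rw [leibniz_pow_succ D hL, smul_mul_assoc, mul_assoc, ← Nat.cast_succ, ← nsmul_eq_mul,
      ← Nat.cast_smul_eq_nsmul ℚ, smul_smul]
    congr 1
    rw [Nat.factorial_succ]
    have := Nat.factorial_ne_zero m
    push_cast
    field_simp
  have h4 := dvd_sub h1 h2
  rw [map_sub, h3, sub_mul] at h4
  simpa using h4

/-- Both sides are inverse to `expSharp (-(u + v))`: each product has derivative zero and constant
term one, which forces it to be one over a ring without additive torsion. -/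
theorem expSharp_add {u v : R⟦X⟧} (hu : PowerSeries.constantCoeff u = 0)
    (hv : PowerSeries.constantCoeff v = 0) :
    expSharp (u + v) = expSharp u * expSharp v := by
  have : IsAddTorsionFree R := IsAddTorsionFree.of_module_rat R
  have hd : ∀ {w : R⟦X⟧}, PowerSeries.constantCoeff w = 0 →
      PowerSeries.derivative R (expSharp w) = expSharp w * PowerSeries.derivative R w :=
    fun hw => derivation_expSharp (PowerSeries.derivative R).toLinearMap.toAddMonoidHom
      (fun a b => (PowerSeries.derivative R).leibniz a b) X_pow_dvd_derivative hw
  have huv : PowerSeries.constantCoeff (u + v) = 0 := by rw [map_add, hu, hv, add_zero]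
  have hn : PowerSeries.constantCoeff (-(u + v)) = 0 := by rw [map_neg, huv, neg_zero]
  have h1 : expSharp (u + v) * expSharp (-(u + v)) = 1 := by
    refine PowerSeries.derivative.ext ?_ ?_
    · rw [Derivation.leibniz, hd huv, hd hn, map_neg]
      simp only [smul_eq_mul, Derivation.map_one_eq_zero]
      ring
    · rw [map_mul, constantCoeff_expSharp huv, constantCoeff_expSharp hn, map_one, mul_one]
  have h2 : expSharp u * expSharp v * expSharp (-(u + v)) = 1 := by
    refine PowerSeries.derivative.ext ?_ ?_
    · rw [Derivation.leibniz, Derivation.leibniz, hd hu, hd hv, hd hn, map_neg, map_add]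
      simp only [smul_eq_mul, Derivation.map_one_eq_zero]
      ring
    · rw [map_mul, map_mul, constantCoeff_expSharp hu, constantCoeff_expSharp hv,
        constantCoeff_expSharp hn, map_one, mul_one, mul_one]
  calc expSharp (u + v) = expSharp (u + v) * (expSharp u * expSharp v * expSharp (-(u + v))) := by
        rw [h2, mul_one]
    _ = expSharp u * expSharp v * (expSharp (u + v) * expSharp (-(u + v))) := by ring
    _ = _ := by rw [h1, mul_one]

end ExpSharp

/-! ### Regrading: `I = n⁻¹`, `x = τ / n` -/

/-- The substitution `I = n⁻¹`, `x = τ / n` in a power series in `I` and `x`, as a function. -/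
noncomputable def diagFun (c : ℂ⟦X⟧⟦X⟧) : ℂ[X]⟦X⟧ :=
  PowerSeries.mk fun N => ∑ p ∈ Finset.range (N + 1),
    Polynomial.C (PowerSeries.coeff p (PowerSeries.coeff (N - p) c)) * Polynomial.X ^ p

theorem coeff_diagFun (c : ℂ⟦X⟧⟦X⟧) (N p : ℕ) : (PowerSeries.coeff N (diagFun c)).coeff p =
    if p ≤ N then PowerSeries.coeff p (PowerSeries.coeff (N - p) c) else 0 := by
  rw [diagFun, PowerSeries.coeff_mk, Polynomial.finsetSum_coeff]
  simp only [Polynomial.coeff_C_mul_X_pow]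
  rw [Finset.sum_ite_eq]
  simp

theorem sum_antidiagonal_shift (F : ℕ → ℕ → ℂ) (N a b : ℕ) :
    ∑ i ∈ Finset.HasAntidiagonal.antidiagonal N,
      (if a ≤ i.1 ∧ b ≤ i.2 then F (i.1 - a) (i.2 - b) else 0) =
    if a + b ≤ N then ∑ i ∈ Finset.HasAntidiagonal.antidiagonal (N - (a + b)), F i.1 i.2 else 0 := by
  split_ifs with h
  · symm
    refine Finset.sum_of_injOn (fun i => (i.1 + a, i.2 + b)) ?_ ?_ ?_ ?_
    · intro i _ j _ hij
      simp only [Prod.mk.injEq, add_left_inj] at hij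
      exact Prod.ext hij.1 hij.2
    · intro i hi
      simp only [Finset.mem_coe, Finset.HasAntidiagonal.mem_antidiagonal] at hi ⊢
      omega
    · intro i hi hni
      rw [if_neg]
      rintro ⟨h1, h2⟩
      refine hni ⟨(i.1 - a, i.2 - b), ?_, ?_⟩
      · simp only [Finset.mem_coe, Finset.HasAntidiagonal.mem_antidiagonal] at hi ⊢
        omega
      · ext <;> simp <;> omega
    · intro i _
      simp
  · refine Finset.sum_eq_zero fun i hi => if_neg ?_
    rw [Finset.HasAntidiagonal.mem_antidiagonal] at hi
    omega

/-- The substitution `I = n⁻¹`, `x = τ / n` in a power series in `I` and `x`. -/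
noncomputable def diag : ℂ⟦X⟧⟦X⟧ →+* ℂ[X]⟦X⟧ where
  toFun := diagFun
  map_one' := by
    ext N p
    rw [coeff_diagFun, PowerSeries.coeff_one, PowerSeries.coeff_one]
    by_cases hN : N = 0
    · subst hN
      by_cases hp : p = 0 <;> simp [hp, Polynomial.coeff_one]
    · rw [if_neg hN, Polynomial.coeff_zero]
      split_ifs with h1 h2
      · rw [PowerSeries.coeff_one, if_neg (by omega)]
      · simp
      · rfl
  map_zero' := by ext; simp [diagFun]
  map_add' a b := by
    ext N p
    simp [diagFun, add_mul, Finset.sum_add_distrib]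
  map_mul' a b := by
    ext N p
    rw [coeff_diagFun, PowerSeries.coeff_mul, PowerSeries.coeff_mul, map_sum,
      Polynomial.finsetSum_coeff]
    simp only [PowerSeries.coeff_mul, Polynomial.coeff_mul, coeff_diagFun]
    rw [Finset.sum_comm, Finset.sum_comm (s := Finset.HasAntidiagonal.antidiagonal N)]
    -- For a fixed splitting of the power of `τ`, the factors need `q.1 ≤ i.1` and `q.2 ≤ i.2`;
    -- removing these shifts leaves the convolution in `I` alone.
    have h : ∀ q ∈ Finset.HasAntidiagonal.antidiagonal p, ∑ i ∈ Finset.HasAntidiagonal.antidiagonal N,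
        ((if q.1 ≤ i.1 then PowerSeries.coeff q.1 (PowerSeries.coeff (i.1 - q.1) a) else 0) *
          if q.2 ≤ i.2 then PowerSeries.coeff q.2 (PowerSeries.coeff (i.2 - q.2) b) else 0) =
        if p ≤ N then ∑ i ∈ Finset.HasAntidiagonal.antidiagonal (N - p),
          PowerSeries.coeff q.1 (PowerSeries.coeff i.1 a) *
            PowerSeries.coeff q.2 (PowerSeries.coeff i.2 b) else 0 := by
      intro q hq
      rw [Finset.HasAntidiagonal.mem_antidiagonal] at hq
      have := sum_antidiagonal_shift (fun r s => PowerSeries.coeff q.1 (PowerSeries.coeff r a) *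
            PowerSeries.coeff q.2 (PowerSeries.coeff s b)) N q.1 q.2
      rw [hq] at this
      rw [← this]
      refine Finset.sum_congr rfl fun i _ => ?_
      by_cases h1 : q.1 ≤ i.1 <;> by_cases h2 : q.2 ≤ i.2 <;> simp [h1, h2]
    rw [Finset.sum_congr rfl h]
    split_ifs <;> simp

theorem coeff_diag (c : ℂ⟦X⟧⟦X⟧) (N p : ℕ) : (PowerSeries.coeff N (diag c)).coeff p =
    if p ≤ N then PowerSeries.coeff p (PowerSeries.coeff (N - p) c) else 0 :=
  coeff_diagFun c N p

theorem diag_X : diag PowerSeries.X = PowerSeries.X := by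
  ext N p
  rw [coeff_diag, PowerSeries.coeff_X, PowerSeries.coeff_X]
  by_cases hN : N = 1
  · subst hN
    rw [if_pos rfl]
    rcases Nat.lt_or_ge 1 p with hp | hp
    · rw [if_neg (by omega), Polynomial.coeff_one, if_neg (by omega)]
    · interval_cases p <;> simp [Polynomial.coeff_one]
  · rw [if_neg hN]
    split_ifs with h1 h2
    · rw [PowerSeries.coeff_one, if_neg (by omega), Polynomial.coeff_zero]
    · simp
    · simp

theorem diag_C_X : diag (PowerSeries.C PowerSeries.X) =
    PowerSeries.C Polynomial.X * PowerSeries.X := by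
  ext N p
  rw [coeff_diag, PowerSeries.coeff_C, PowerSeries.coeff_C_mul, PowerSeries.coeff_X]
  by_cases hN : N = 1
  · subst hN
    rw [if_pos rfl, mul_one, Polynomial.coeff_X]
    rcases Nat.lt_or_ge 1 p with hp | hp
    · rw [if_neg (by omega), if_neg (by omega)]
    · interval_cases p <;> simp
  · rw [if_neg hN]
    split_ifs with h1 h2
    · rw [PowerSeries.coeff_X, if_neg (by omega), mul_zero, Polynomial.coeff_zero]
    · simp
    · simp

theorem coeff_diag_C (F : ℂ⟦X⟧) (N p : ℕ) :
    (PowerSeries.coeff N (diag (PowerSeries.C F))).coeff p =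
      if p = N then PowerSeries.coeff N F else 0 := by
  rw [coeff_diag, PowerSeries.coeff_C]
  by_cases h : p = N
  · simp [h]
  · rw [if_neg h]
    split_ifs with h1 h2
    · omega
    · simp
    · rfl

/-- The derivation `α n⁻¹ ∂_{n⁻¹} + β τ ∂_τ`. -/
noncomputable def euler (α β : ℂ) : ℂ[X]⟦X⟧ →+ ℂ[X]⟦X⟧ where
  toFun a := PowerSeries.mk fun N => Polynomial.C (α * N) * PowerSeries.coeff N a +
    Polynomial.C β * (Polynomial.X * Polynomial.derivative (PowerSeries.coeff N a))
  map_zero' := by ext1 N; simp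
  map_add' a b := by
    ext1 N
    simp only [PowerSeries.coeff_mk, map_add]
    ring

theorem coeff_euler (α β : ℂ) (a : ℂ[X]⟦X⟧) (N p : ℕ) :
    (PowerSeries.coeff N (euler α β a)).coeff p =
      (α * N + β * p) * (PowerSeries.coeff N a).coeff p := by
  change (PowerSeries.coeff N (PowerSeries.mk fun N =>
    Polynomial.C (α * N) * PowerSeries.coeff N a +
    Polynomial.C β * (Polynomial.X * Polynomial.derivative (PowerSeries.coeff N a))) :
      ℂ[X]).coeff p = _
  rw [PowerSeries.coeff_mk, Polynomial.coeff_add, Polynomial.coeff_C_mul, Polynomial.coeff_C_mul]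
  cases p with
  | zero => simp
  | succ p =>
    rw [Polynomial.coeff_X_mul, Polynomial.coeff_derivative]
    push_cast
    ring

theorem euler_mul (α β : ℂ) (a b : ℂ[X]⟦X⟧) :
    euler α β (a * b) = a * euler α β b + b * euler α β a := by
  rw [mul_comm b]
  ext N p
  rw [coeff_euler, map_add, Polynomial.coeff_add, PowerSeries.coeff_mul, PowerSeries.coeff_mul,
    PowerSeries.coeff_mul]
  simp only [Polynomial.finsetSum_coeff, Polynomial.coeff_mul, coeff_euler]
  rw [Finset.mul_sum, ← Finset.sum_add_distrib]
  refine Finset.sum_congr rfl fun i hi => ?_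
  rw [Finset.mul_sum, ← Finset.sum_add_distrib]
  refine Finset.sum_congr rfl fun j hj => ?_
  rw [Finset.HasAntidiagonal.mem_antidiagonal] at hi hj
  rw [← hi, ← hj]
  push_cast
  ring

theorem euler_expSharp (α β : ℂ) {u : ℂ[X]⟦X⟧} (hu : PowerSeries.constantCoeff u = 0) :
    euler α β (expSharp u) = expSharp u * euler α β u := by
  refine derivation_expSharp _ (euler_mul α β) (fun M a h => ?_) hu
  rw [PowerSeries.X_pow_dvd_iff] at h ⊢
  intro N hN
  ext p
  rw [coeff_euler, h N (by omega), Polynomial.coeff_zero, mul_zero]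

/-- On functions of `x = τ/n` both `n⁻¹ ∂_{n⁻¹}` and `τ ∂_τ` act as `x ∂_x`. In particular `euler 1
(-1)` annihilates them. -/
theorem euler_diag_C (α β : ℂ) (F : ℂ⟦X⟧) : euler α β (diag (PowerSeries.C F)) =
    diag (PowerSeries.C ((α + β) • (PowerSeries.X * PowerSeries.derivative ℂ F))) := by
  ext N p
  rw [coeff_euler, coeff_diag_C, coeff_diag_C]
  split_ifs with h
  · subst h
    rw [PowerSeries.coeff_smul]
    cases p with
    | zero => simp
    | succ p =>
      rw [PowerSeries.coeff_succ_X_mul, PowerSeries.coeff_derivative, smul_eq_mul]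
      push_cast
      ring
  · simp

theorem euler_tau (α β : ℂ) : euler α β (PowerSeries.C Polynomial.X) =
    PowerSeries.C (Polynomial.C β * Polynomial.X) := by
  ext N p
  rw [coeff_euler, PowerSeries.coeff_C, PowerSeries.coeff_C]
  split_ifs with hN
  · rw [Polynomial.coeff_C_mul, Polynomial.coeff_X]
    split_ifs with h
    · simp [← h, hN]
    · simp
  · simp

/-! ### Weights -/

/-- Only monomials `n^(-N) τ^p` of weight `(κ+1) N - κ p ≥ k` occur in `a`. -/
def WtGE (κ k : ℕ) (a : ℂ[X]⟦X⟧) : Prop :=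
  ∀ N p : ℕ, (PowerSeries.coeff N a).coeff p ≠ 0 → k + κ * p ≤ (κ + 1) * N

theorem SlopeLE.wtGE {κ : ℕ} {a : ℂ[X]⟦X⟧} (ha : SlopeLE κ a) : WtGE κ 0 a := by
  intro N p h
  have h1 := ha N p h
  by_contra hlt
  have h2 : (κ + 1) * N + 1 ≤ κ * p := by omega
  nlinarith

theorem WtGE.mul {κ k l : ℕ} {u v : ℂ[X]⟦X⟧} (hu : WtGE κ k u) (hv : WtGE κ l v) :
    WtGE κ (k + l) (u * v) := by
  intro N p h
  rw [PowerSeries.coeff_mul, Polynomial.finsetSum_coeff] at h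
  obtain ⟨⟨a, b⟩, hab, h⟩ := Finset.exists_ne_zero_of_sum_ne_zero h
  rw [Polynomial.coeff_mul] at h
  obtain ⟨⟨c, d⟩, hcd, h⟩ := Finset.exists_ne_zero_of_sum_ne_zero h
  have h1 := hu a c (left_ne_zero_of_mul h)
  have h2 := hv b d (right_ne_zero_of_mul h)
  rw [Finset.HasAntidiagonal.mem_antidiagonal] at hab hcd
  simp only at hab hcd
  rw [← hab, ← hcd]
  nlinarith

theorem wtGE_X_pow (κ r : ℕ) : WtGE κ ((κ + 1) * r) (PowerSeries.X ^ r) := by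
  intro N p h
  rw [PowerSeries.coeff_X_pow] at h
  split_ifs at h with hN
  · rw [Polynomial.coeff_one] at h
    split_ifs at h with hp
    · simp [hN, hp]
    · exact absurd rfl h
  · simp at h

theorem wtGE_diag_C (κ k : ℕ) {F : ℂ⟦X⟧} (hF : PowerSeries.X ^ k ∣ F) :
    WtGE κ k (diag (PowerSeries.C F)) := by
  intro N p h
  rw [coeff_diag_C] at h
  split_ifs at h with hp
  · have : k ≤ N := by
      by_contra hlt
      exact h (PowerSeries.X_pow_dvd_iff.1 hF N (by omega))
    rw [hp]
    nlinarith
  · exact absurd rfl h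

theorem SlopeLE.add {κ : ℕ} {a b : ℂ[X]⟦X⟧} (ha : SlopeLE κ a) (hb : SlopeLE κ b) :
    SlopeLE κ (a + b) := by
  intro N p h
  by_cases h1 : (PowerSeries.coeff N a).coeff p = 0
  · refine hb N p fun h2 => h ?_
    rw [map_add, Polynomial.coeff_add, h1, h2, add_zero]
  · exact ha N p h1

theorem SlopeLE.neg {κ : ℕ} {a : ℂ[X]⟦X⟧} (ha : SlopeLE κ a) : SlopeLE κ (-a) := by
  intro N p h
  refine ha N p fun h1 => h ?_
  rw [map_neg, Polynomial.coeff_neg, h1, neg_zero]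

theorem slopeLE_diag (κ : ℕ) (c : ℂ⟦X⟧⟦X⟧) : SlopeLE κ (diag c) := by
  intro N p h
  rw [coeff_diag] at h
  split_ifs at h with hp
  · nlinarith
  · exact absurd rfl h

theorem SlopeLE.euler {κ : ℕ} {a : ℂ[X]⟦X⟧} (ha : SlopeLE κ a) (α β : ℂ) :
    SlopeLE κ (euler α β a) := by
  intro N p h
  rw [coeff_euler] at h
  exact ha N p (right_ne_zero_of_mul h)

theorem slopeLE_X (κ : ℕ) : SlopeLE κ PowerSeries.X := by
  rw [← diag_X]
  exact slopeLE_diag κ _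

/-! ### The term by term Laplace–Borel integration -/

/-- The coefficient in `n^(-N) τ^p ↦ (coefficient) ν^q`, with `q = nirExponent κ N p`. -/
noncomputable def kern (κ : ℕ) (ω : ℂ) (N p : ℕ) : ℂ :=
  laplaceConst κ ω p / ((Real.Gamma ((nirExponent κ N p : ℝ) + 1) : ℝ) : ℂ)

/-- The coefficients of the series in `ν` obtained from a series in `n⁻¹`, `τ` by the term by term
Laplace integration in `τ` and Borel integration in `n`. -/
noncomputable def lam (κ : ℕ) (ω : ℂ) (a : ℂ[X]⟦X⟧) (q : ℚ) : ℂ :=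
  ∑ᶠ i : ℕ × ℕ, if nirExponent κ i.1 i.2 = q then
    (PowerSeries.coeff i.1 a).coeff i.2 * kern κ ω i.1 i.2 else 0

theorem nirExponent_eq_div (κ N p : ℕ) :
    nirExponent κ N p = (((κ : ℚ) + 1) * N - κ * p - κ) / (κ + 1) := by
  have : (κ : ℚ) + 1 ≠ 0 := by positivity
  unfold nirExponent
  field_simp
  ring

theorem nirExponent_succ (κ N p : ℕ) : nirExponent κ (N + 1) p = nirExponent κ N p + 1 := by
  unfold nirExponent
  push_cast
  ring

theorem nirExponent_shift (κ N p : ℕ) :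
    nirExponent κ (N + κ) (p + (κ + 1)) = nirExponent κ N p := by
  have : (κ : ℚ) + 1 ≠ 0 := by positivity
  unfold nirExponent
  push_cast
  field_simp
  ring

theorem kern_succ (κ : ℕ) (ω : ℂ) (N p : ℕ) :
    ((nirExponent κ N p + 1 : ℚ) : ℂ) * kern κ ω (N + 1) p = kern κ ω N p := by
  unfold kern
  rw [nirExponent_succ]
  push_cast
  by_cases h : (nirExponent κ N p : ℝ) + 1 = 0
  -- At the pole both sides vanish: `Real.Gamma 0 = 0` and division by zero is zero, which agrees
  -- with the true value `1/Γ(0) = 0`.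
  · have h' : (nirExponent κ N p : ℂ) + 1 = 0 := by exact_mod_cast h
    rw [h, h', Real.Gamma_zero]
    simp
  · have h' : (nirExponent κ N p : ℂ) + 1 ≠ 0 := by exact_mod_cast h
    rw [Real.Gamma_add_one h]
    push_cast
    rw [div_eq_mul_inv, mul_inv, div_eq_mul_inv]
    field_simp

/-- Integration of `∂_τ (τ^(p+1) exp(-f_κ n^(-κ) τ^(κ+1)/(κ+1)))` over the half-line gives zero; on
the constants this is `Γ(s+1) = s Γ(s)` with `s = (p+1)/(κ+1)`. -/
theorem kern_parts (κ : ℕ) {ω : ℂ} (hω : ω ≠ 0) (N p : ℕ) :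
    ω ^ (κ + 1) * kern κ ω (N + κ) (p + (κ + 1)) = ((p : ℂ) + 1) * kern κ ω N p := by
  unfold kern
  rw [nirExponent_shift, ← mul_div_assoc, ← mul_div_assoc]
  congr 1
  unfold laplaceConst
  set s : ℝ := ((p : ℝ) + 1) / ((κ : ℝ) + 1) with hs
  have hk : (0 : ℝ) < (κ : ℝ) + 1 := by positivity
  have hs0 : 0 < s := by positivity
  have h1 : (((p + (κ + 1) : ℕ) : ℝ) + 1) / ((κ : ℝ) + 1) = s + 1 := by
    rw [hs]; push_cast; field_simp; ring
  rw [h1, Real.Gamma_add_one hs0.ne', show s + 1 - 1 = (s - 1) + 1 by ring,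
    Real.rpow_add_one hk.ne']
  have h2 : (p : ℝ) + 1 = ((κ : ℝ) + 1) * s := by rw [hs]; field_simp
  have h3 : (p : ℂ) + 1 = (((κ : ℝ) + 1) * s : ℝ) := by rw [← h2]; push_cast; ring
  rw [h3, show p + (κ + 1) + 1 = (p + 1) + (κ + 1) by ring, pow_add]
  push_cast
  field_simp
  ring

theorem finsum_shift (F : ℕ × ℕ → ℂ) (a b : ℕ)
    (h : ∀ i : ℕ × ℕ, ¬(a ≤ i.1 ∧ b ≤ i.2) → F i = 0) :
    ∑ᶠ i, F i = ∑ᶠ i : ℕ × ℕ, F (i.1 + a, i.2 + b) := by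
  have hg : Function.Injective fun i : ℕ × ℕ => (i.1 + a, i.2 + b) := by
    intro i j hij
    simp only [Prod.mk.injEq, add_left_inj] at hij
    exact Prod.ext hij.1 hij.2
  rw [← finsum_mem_range (f := F) hg, ← finsum_mem_univ]
  refine finsum_mem_inter_support_eq F _ _ ?_
  ext i
  simp only [Set.univ_inter, Set.mem_inter_iff, Function.mem_support]
  refine ⟨fun hi => ⟨?_, hi⟩, fun hi => hi.2⟩
  by_contra hni
  refine hi (h i fun hab => hni ⟨(i.1 - a, i.2 - b), ?_⟩)
  ext <;> simp <;> omega

theorem lam_shift (κ : ℕ) (ω : ℂ) (a b : ℕ) (c : ℂ[X]⟦X⟧) (q : ℚ) :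
    lam κ ω (PowerSeries.X ^ a * PowerSeries.C Polynomial.X ^ b * c) q =
      ∑ᶠ i : ℕ × ℕ, if nirExponent κ (i.1 + a) (i.2 + b) = q then
        (PowerSeries.coeff i.1 c).coeff i.2 * kern κ ω (i.1 + a) (i.2 + b) else 0 := by
  have hc : ∀ N p, (PowerSeries.coeff N
      (PowerSeries.X ^ a * PowerSeries.C Polynomial.X ^ b * c : ℂ[X]⟦X⟧)).coeff p =
      if a ≤ N ∧ b ≤ p then (PowerSeries.coeff (N - a) c).coeff (p - b) else 0 := by
    intro N p
    rw [mul_assoc, PowerSeries.coeff_X_pow_mul', ← map_pow, ite_and]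
    split_ifs with h1 h2
    · rw [PowerSeries.coeff_C_mul, Polynomial.coeff_X_pow_mul', if_pos h2]
    · rw [PowerSeries.coeff_C_mul, Polynomial.coeff_X_pow_mul', if_neg h2]
    · simp
  unfold lam
  rw [finsum_shift _ a b]
  · refine finsum_congr fun i => ?_
    simp only [hc]
    rw [if_pos (show a ≤ i.1 + a ∧ b ≤ i.2 + b by omega), Nat.add_sub_cancel, Nat.add_sub_cancel]
  · intro i hi
    rw [hc, if_neg hi, zero_mul, ite_self]

/-- Multiplication by `n⁻¹` is inverse to `∂_ν`. -/
theorem lam_X_mul (κ : ℕ) (ω : ℂ) (a : ℂ[X]⟦X⟧) (q : ℚ) :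
    ((q + 1 : ℚ) : ℂ) * lam κ ω (PowerSeries.X * a) (q + 1) = lam κ ω a q := by
  have := lam_shift κ ω 1 0 a (q + 1)
  rw [pow_one, pow_zero, mul_one] at this
  rw [this, ← smul_eq_mul, smul_finsum]
  refine finsum_congr fun i => ?_
  rw [add_zero, nirExponent_succ]
  by_cases h : nirExponent κ i.1 i.2 = q
  · rw [if_pos h, if_pos (by rw [h]), ← kern_succ κ ω i.1 i.2, h, smul_eq_mul]
    ring
  · rw [if_neg h, if_neg (by simpa using h), smul_zero]

/-- Integration by parts in `τ`. -/
theorem lam_parts (κ : ℕ) {ω : ℂ} (hω : ω ≠ 0) (a : ℂ[X]⟦X⟧) (q : ℚ) :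
    lam κ ω (euler 0 1 a + a) q = ω ^ (κ + 1) *
      lam κ ω (PowerSeries.X ^ κ * PowerSeries.C Polynomial.X ^ (κ + 1) * a) q := by
  rw [lam_shift, ← smul_eq_mul, smul_finsum]
  refine finsum_congr fun i => ?_
  rw [nirExponent_shift]
  split_ifs with h
  · rw [map_add, Polynomial.coeff_add, coeff_euler, smul_eq_mul, mul_left_comm, kern_parts κ hω]
    ring
  · rw [smul_zero]

/-- Multiplication by `ν`. -/
theorem lam_sub_one (κ : ℕ) (ω : ℂ) (a c : ℂ[X]⟦X⟧) (q : ℚ)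
    (hc : ∀ N p, (PowerSeries.coeff N c).coeff p =
      ((nirExponent κ N p + 1 : ℚ) : ℂ) * (PowerSeries.coeff N a).coeff p) :
    lam κ ω a (q - 1) = lam κ ω (PowerSeries.X * c) q := by
  have := lam_shift κ ω 1 0 c q
  rw [pow_one, pow_zero, mul_one] at this
  rw [this, lam]
  refine finsum_congr fun i => ?_
  rw [add_zero, nirExponent_succ, hc]
  simp only [eq_sub_iff_add_eq]
  split_ifs
  · rw [← kern_succ κ ω i.1 i.2]
    ring
  · rfl

/-- The exponent `q` only fixes the weight `w = (κ+1) N - κ p`, and infinitely many `(N, p)` share a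
weight. The slope bound supplies the missing inequality `N ≤ (κ+1) w`. -/
theorem finite_support_lam {κ : ℕ} (ω : ℂ) {a : ℂ[X]⟦X⟧} (ha : SlopeLE κ a) (q : ℚ) :
    (Function.support fun i : ℕ × ℕ => if nirExponent κ i.1 i.2 = q then
      (PowerSeries.coeff i.1 a).coeff i.2 * kern κ ω i.1 i.2 else 0).Finite := by
  obtain ⟨M, hM⟩ := exists_nat_ge ((q * (κ + 1) + κ) * (κ + 1))
  refine ((Set.finite_Iic M).prod (Set.finite_Iic (2 * M))).subset ?_
  rintro ⟨N, p⟩ h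
  rw [Function.mem_support] at h
  split_ifs at h with hq
  · have h1 := ha N p (left_ne_zero_of_mul h)
    obtain ⟨w, hw, hN⟩ := nirExponent_eq _ _ _ h1
    have hpos : (κ : ℚ) + 1 ≠ 0 := by positivity
    have hwq : (w : ℚ) = q * (κ + 1) + κ := by
      simp only at hq
      rw [← hq, hw]; field_simp; ring
    have hNM : N ≤ M := by
      have : (N : ℚ) ≤ M := by
        refine le_trans ?_ hM
        rw [← hwq]
        have : (N : ℚ) ≤ ((κ + 1) * w : ℕ) := by exact_mod_cast hN
        push_cast at this
        linarith
      exact_mod_cast this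
    refine ⟨hNM, ?_⟩
    have : p ≤ 2 * N := by nlinarith
    simp only [Set.mem_Iic]
    omega
  · exact absurd rfl h

theorem lam_add {κ : ℕ} (ω : ℂ) {a b : ℂ[X]⟦X⟧} (ha : SlopeLE κ a) (hb : SlopeLE κ b) (q : ℚ) :
    lam κ ω (a + b) q = lam κ ω a q + lam κ ω b q := by
  unfold lam
  rw [← finsum_add_distrib (finite_support_lam ω ha q) (finite_support_lam ω hb q)]
  refine finsum_congr fun i => ?_
  rw [map_add, Polynomial.coeff_add, add_mul]
  split_ifs <;> simp

theorem lam_const_mul (κ : ℕ) (ω c : ℂ) (a : ℂ[X]⟦X⟧) (q : ℚ) :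
    lam κ ω (PowerSeries.C (Polynomial.C c) * a) q = c * lam κ ω a q := by
  unfold lam
  rw [← smul_eq_mul (a := c), smul_finsum]
  refine finsum_congr fun i => ?_
  rw [PowerSeries.coeff_C_mul, Polynomial.coeff_C_mul]
  split_ifs <;> simp [mul_assoc]

theorem lam_ne_zero {κ k : ℕ} {ω : ℂ} {a : ℂ[X]⟦X⟧} (ha : WtGE κ k a) {q : ℚ}
    (h : lam κ ω a q ≠ 0) : ∃ w : ℕ, k ≤ w ∧ q = ((w : ℚ) - κ) / (κ + 1) := by
  obtain ⟨i, hi⟩ : ∃ i : ℕ × ℕ, (if nirExponent κ i.1 i.2 = q then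
      (PowerSeries.coeff i.1 a).coeff i.2 * kern κ ω i.1 i.2 else 0) ≠ 0 := by
    by_contra! h0
    exact h (finsum_eq_zero_of_forall_eq_zero h0)
  split_ifs at hi with hq
  · have h1 := ha i.1 i.2 (left_ne_zero_of_mul hi)
    refine ⟨(κ + 1) * i.1 - κ * i.2, by omega, ?_⟩
    rw [← hq, nirExponent_eq_div, Nat.cast_sub (by omega)]
    push_cast
    ring
  · exact absurd rfl hi

theorem lam_eq_zero {κ k : ℕ} {ω : ℂ} {a : ℂ[X]⟦X⟧} (ha : WtGE κ k a) {q : ℚ}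
    (hq : q < ((k : ℚ) - κ) / (κ + 1)) : lam κ ω a q = 0 := by
  by_contra h
  obtain ⟨w, hw, hqw⟩ := lam_ne_zero ha h
  rw [hqw, div_lt_div_iff_of_pos_right (by positivity)] at hq
  have : (k : ℚ) ≤ w := by exact_mod_cast hw
  linarith

/-- The leading coefficient. -/
theorem lam_lead {κ : ℕ} (ω : ℂ) {b : ℂ[X]⟦X⟧} (hb : SlopeLE κ b)
    (hb0 : (PowerSeries.coeff 0 b).coeff 0 = 1) (k : ℕ) :
    lam κ ω (diag (PowerSeries.C (PowerSeries.X ^ k)) * b) (((k : ℚ) - κ) / (κ + 1)) =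
      (ω ^ (k + 1))⁻¹ *
        ((((κ : ℝ) + 1) ^ (((k : ℝ) + 1) / ((κ : ℝ) + 1) - 1) : ℝ) : ℂ) := by
  rw [map_pow, map_pow, diag_C_X, mul_pow, mul_comm (PowerSeries.C _ ^ k), lam_shift,
    finsum_eq_single _ (0, 0)]
  · have hk : nirExponent κ k k = ((k : ℚ) - κ) / (κ + 1) := by
      rw [nirExponent_eq_div]; ring
    simp only [zero_add]
    rw [if_pos hk, hb0, one_mul, kern, hk, laplaceConst]
    -- The Borel factor has the same argument as the Laplace factor, so the two values of `Γ`
    -- cancel.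
    have h1 : ((((k : ℚ) - κ) / (κ + 1) : ℚ) : ℝ) + 1 = ((k : ℝ) + 1) / ((κ : ℝ) + 1) := by
      have : (κ : ℝ) + 1 ≠ 0 := by positivity
      push_cast
      field_simp
      ring
    rw [h1]
    have h2 : Real.Gamma (((k : ℝ) + 1) / ((κ : ℝ) + 1)) ≠ 0 :=
      (Real.Gamma_pos_of_pos (by positivity)).ne'
    have h3 : ((Real.Gamma (((k : ℝ) + 1) / ((κ : ℝ) + 1)) : ℝ) : ℂ) ≠ 0 := by
      exact_mod_cast h2
    rw [Complex.ofReal_mul, ← mul_assoc, mul_div_cancel_right₀ _ h3]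
  · rintro ⟨N, p⟩ hne
    split_ifs with hq
    · by_cases h : (PowerSeries.coeff N b).coeff p = 0
      · rw [h, zero_mul]
      · exfalso
        have h1 := hb N p h
        have h2 := hb.wtGE N p h
        simp only at hq
        rw [nirExponent_eq_div, div_left_inj' (by positivity)] at hq
        push_cast at hq
        have h3 : ((κ : ℚ) + 1) * N = κ * p := by linarith
        have h4 : (κ + 1) * N = κ * p := by exact_mod_cast h3
        -- The line of weight zero meets the slope region only at the origin: together they give
        -- `(κ+1)² p ≤ ((κ+1)² - 1) p`.
        have hp : p = 0 := by nlinarith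
        subst hp
        have hN : N = 0 := by simpa using h4
        exact hne (by rw [hN])
    · rfl

/-! ### The factorisation of the integrand of `nir` -/

/-- `(f* - f_κ x^(κ+1) / (κ+1)) / x`. -/
noncomputable def primitiveTail (f : ℂ⟦X⟧) : ℂ⟦X⟧ :=
  PowerSeries.mk fun N => if N = tangency f then 0 else PowerSeries.coeff N f / ((N : ℂ) + 1)

/-- The logarithm of the perturbative factor of the integrand which is of order `≥ 1` in `∂_x`,
as a series in `I = n⁻¹` and `x = τ / n`. -/
noncomputable def derivativePart (f : ℂ⟦X⟧) : ℂ⟦X⟧⟦X⟧ :=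
  -PowerSeries.mk fun r => if r = 0 then 0 else
    beta (r : ℤ) • (fun F => PowerSeries.derivative ℂ F)^[r] f

theorem coeff_eq_zero_of_lt_tangency {f : ℂ⟦X⟧} {N : ℕ} (hN : N < tangency f) :
    PowerSeries.coeff N f = 0 := by
  refine PowerSeries.coeff_of_lt_order N ?_
  by_contra hle
  exact absurd (ENat.toNat_le_of_le_natCast (not_lt.1 hle)) (not_le.2 hN)

theorem primitive_eq (f : ℂ⟦X⟧) : primitive f = PowerSeries.X * primitiveTail f +
    PowerSeries.C (PowerSeries.coeff (tangency f) f / ((tangency f : ℂ) + 1)) *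
      PowerSeries.X ^ (tangency f + 1) := by
  ext N
  rw [primitive, PowerSeries.coeff_mk, map_add, PowerSeries.coeff_C_mul, PowerSeries.coeff_X_pow]
  cases N with
  | zero => simp
  | succ N =>
    rw [PowerSeries.coeff_succ_X_mul, primitiveTail, PowerSeries.coeff_mk]
    by_cases h : N = tangency f
    · simp [h]
    · simp [h]

theorem derivative_primitive (f : ℂ⟦X⟧) : PowerSeries.derivative ℂ (primitive f) = f := by
  ext N
  rw [PowerSeries.coeff_derivative, primitive, PowerSeries.coeff_mk, if_neg N.succ_ne_zero]
  have : (N : ℂ) + 1 ≠ 0 := by exact_mod_cast N.succ_ne_zero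
  simp only [Nat.add_sub_cancel]
  push_cast
  field_simp

theorem betaStar_coeff_le {k p : ℕ} (h : p ≤ k) :
    (betaStar k).coeff p = beta ((k - p : ℕ) : ℤ) * (k.factorial : ℂ) / (p.factorial : ℂ) := by
  unfold betaStar
  rw [Polynomial.finsetSum_coeff, Finset.sum_eq_single (k + 1 - p)]
  · rw [Polynomial.coeff_C_mul_X_pow, if_pos (by omega)]
    rw [show k + 1 - (k + 1 - p) = p by omega,
      show (((k + 1 - p : ℕ) : ℤ) - 1) = ((k - p : ℕ) : ℤ) by omega]
  · intro j hj hne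
    rw [Finset.mem_range] at hj
    rw [Polynomial.coeff_C_mul_X_pow, if_neg (by omega)]
  · intro hn
    rw [Finset.mem_range] at hn
    omega

theorem coeff_tau_mul_diag_C (F : ℂ⟦X⟧) (N p : ℕ) :
    (PowerSeries.coeff N (PowerSeries.C Polynomial.X * diag (PowerSeries.C F))).coeff p =
      if p = N + 1 then PowerSeries.coeff N F else 0 := by
  rw [PowerSeries.coeff_C_mul]
  cases p with
  | zero => simp
  | succ p =>
    rw [Polynomial.coeff_X_mul, coeff_diag_C]
    simp

theorem coeff_derivativePart (f : ℂ⟦X⟧) (r p : ℕ) :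
    PowerSeries.coeff p (PowerSeries.coeff r (derivativePart f)) =
      -if r = 0 then 0 else beta (r : ℤ) * (((p + r).factorial : ℂ) / (p.factorial : ℂ) *
        PowerSeries.coeff (p + r) f) := by
  rw [derivativePart, map_neg, map_neg, PowerSeries.coeff_mk]
  congr 1
  split_ifs
  · simp
  · rw [PowerSeries.coeff_smul, smul_eq_mul]
    congr 1
    rw [PowerSeries.coeff_iterate_derivative, ← Nat.factorial_mul_ascFactorial p r]
    have : (p.factorial : ℂ) ≠ 0 := by exact_mod_cast p.factorial_ne_zero
    push_cast
    field_simp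

/-- This is `β(∂_τ) = ∂_τ⁻¹ + ∑_{r ≥ 1} β_r ∂_τ^r` applied to `f(τ/n)`. Monomials with `p = N + 1`
come from `∂_τ⁻¹`, that is from `n f*(x)`, and those with `p ≤ N` from order `r = N - p`. -/
theorem neg_fUp_eq (f : ℂ⟦X⟧) :
    -fUp f = -(PowerSeries.C Polynomial.X * diag (PowerSeries.C (primitiveTail f))) +
      diag (derivativePart f) := by
  ext N p
  rw [map_neg, map_add, map_neg, Polynomial.coeff_neg, Polynomial.coeff_add, Polynomial.coeff_neg,
    coeff_tau_mul_diag_C, coeff_diag, fUp, fUpFull, map_sub, Polynomial.coeff_sub,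
    PowerSeries.coeff_mk, Polynomial.coeff_C_mul, PowerSeries.coeff_monomial]
  have hm : (if N = tangency f then Polynomial.C (PowerSeries.coeff (tangency f) f /
      ((tangency f : ℂ) + 1)) * Polynomial.X ^ (tangency f + 1) else 0 : ℂ[X]).coeff p =
      if N = tangency f ∧ p = N + 1 then PowerSeries.coeff N f / ((N : ℂ) + 1) else 0 := by
    by_cases h : N = tangency f
    · rw [if_pos h, Polynomial.coeff_C_mul_X_pow]
      simp [h]
    · simp [h]
  rw [hm]
  rcases lt_trichotomy p (N + 1) with hp | hp | hp
  · have hpN : p ≤ N := by omega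
    rw [if_neg (fun h => hp.ne h.2), if_neg hp.ne, if_pos hpN, coeff_derivativePart,
      betaStar_coeff_le hpN, show p + (N - p) = N by omega]
    -- Order zero in `∂_τ` contributes nothing because `β_0 = 0`.
    by_cases hr : N - p = 0
    · rw [hr]
      simp [beta_neg_one_zero.2]
    · rw [if_neg hr]
      ring
  · have hpN : ¬p ≤ N := by omega
    rw [if_pos hp, if_neg hpN, hp, betaStar_coeff_top, primitiveTail, PowerSeries.coeff_mk]
    by_cases h : N = tangency f
    · rw [if_pos ⟨h, rfl⟩, if_pos h]
      ring
    · rw [if_neg (fun h' => h h'.1), if_neg h]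
      ring
  · have hpN : ¬p ≤ N := by omega
    have hb : (betaStar N).coeff p = 0 := by
      by_contra h
      rcases betaStar_coeff _ _ h with h | h <;> omega
    rw [if_neg (fun h => hp.ne' h.2), if_neg hp.ne', if_neg hpN, hb]
    ring

/-- `exp_#(-n (f*(x) - f_κ x^(κ+1) / (κ+1)))` with `x = τ / n`. -/
noncomputable def expTail (f : ℂ⟦X⟧) : ℂ[X]⟦X⟧ :=
  expSharp (-(PowerSeries.C Polynomial.X * diag (PowerSeries.C (primitiveTail f))))

/-- A monomial with `p = N + 1` satisfies the slope bound exactly when `N > κ`. This is why the term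
`N = κ` stays in the Laplace kernel and is not expanded. -/
theorem slopeLE_tail (f : ℂ⟦X⟧) : SlopeLE (tangency f)
    (-(PowerSeries.C Polynomial.X * diag (PowerSeries.C (primitiveTail f)))) := by
  refine SlopeLE.neg fun N p h => ?_
  rw [coeff_tau_mul_diag_C] at h
  split_ifs at h with hp
  · rw [primitiveTail, PowerSeries.coeff_mk] at h
    split_ifs at h with hN
    · exact absurd rfl h
    · have : tangency f < N := by
        by_contra hlt
        exact h (by rw [coeff_eq_zero_of_lt_tangency (by omega), zero_div])
      rw [hp]
      nlinarith
  · exact absurd rfl h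

theorem constantCoeff_tail (f : ℂ⟦X⟧) : PowerSeries.constantCoeff
    (-(PowerSeries.C Polynomial.X * diag (PowerSeries.C (primitiveTail f)))) = 0 := by
  refine (slopeLE_tail f).constantCoeff ?_
  rw [map_neg, Polynomial.coeff_neg, coeff_tau_mul_diag_C]
  simp

theorem slopeLE_expTail (f : ℂ⟦X⟧) : SlopeLE (tangency f) (expTail f) :=
  (slopeLE_tail f).expSharp (constantCoeff_tail f)

theorem coeff_zero_expTail (f : ℂ⟦X⟧) :
    (PowerSeries.coeff 0 (expTail f)).coeff 0 = 1 := by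
  rw [PowerSeries.coeff_zero_eq_constantCoeff_apply, expTail,
    constantCoeff_expSharp (constantCoeff_tail f), Polynomial.coeff_one_zero]

theorem constantCoeff_derivativePart (f : ℂ⟦X⟧) :
    PowerSeries.constantCoeff (derivativePart f) = 0 := by
  rw [← PowerSeries.coeff_zero_eq_constantCoeff_apply, derivativePart]
  simp

theorem expSharp_neg_fUp (f : ℂ⟦X⟧) :
    expSharp (-fUp f) = expTail f * diag (expSharp (derivativePart f)) := by
  have hX : (PowerSeries.X : ℂ[X]⟦X⟧) ∣ diag PowerSeries.X := by rw [diag_X]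
  have h0 : PowerSeries.constantCoeff (diag (derivativePart f)) = 0 := by
    rw [← PowerSeries.X_dvd_iff]
    exact hX.trans (map_dvd diag (PowerSeries.X_dvd_iff.2 (constantCoeff_derivativePart f)))
  rw [map_expSharp diag hX (constantCoeff_derivativePart f), expTail,
    ← expSharp_add (constantCoeff_tail f) h0, neg_fUp_eq]

/-! ### The saddle point integral at order zero -/

/-- The term by term integration of `F(x) exp(-n f*(x)) n dx`. -/
noncomputable def saddle (ω : ℂ) (f F : ℂ⟦X⟧) (q : ℚ) : ℂ :=
  lam (tangency f) ω (diag (PowerSeries.C F) * expTail f) q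

theorem slopeLE_diag_mul_expTail (f : ℂ⟦X⟧) (c : ℂ⟦X⟧⟦X⟧) :
    SlopeLE (tangency f) (diag c * expTail f) :=
  (slopeLE_diag _ c).mul (slopeLE_expTail f)

theorem saddle_add (ω : ℂ) (f F G : ℂ⟦X⟧) (q : ℚ) :
    saddle ω f (F + G) q = saddle ω f F q + saddle ω f G q := by
  unfold saddle
  rw [map_add, map_add, add_mul,
    lam_add ω (slopeLE_diag_mul_expTail f _) (slopeLE_diag_mul_expTail f _)]

theorem diag_C_C (c : ℂ) :
    diag (PowerSeries.C (PowerSeries.C c)) = PowerSeries.C (Polynomial.C c) := by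
  ext N p
  rw [coeff_diag_C, PowerSeries.coeff_C, PowerSeries.coeff_C]
  by_cases hN : N = 0
  · subst hN
    rw [if_pos rfl, if_pos rfl, Polynomial.coeff_C]
  · simp [hN]

theorem saddle_C_mul (ω : ℂ) (f : ℂ⟦X⟧) (c : ℂ) (F : ℂ⟦X⟧) (q : ℚ) :
    saddle ω f (PowerSeries.C c * F) q = c * saddle ω f F q := by
  unfold saddle
  rw [map_mul, map_mul, diag_C_C, mul_assoc, lam_const_mul]

theorem saddle_eq_zero (ω : ℂ) (f : ℂ⟦X⟧) {k : ℕ} {F : ℂ⟦X⟧} (hF : PowerSeries.X ^ k ∣ F) {q : ℚ}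
    (hq : q < ((k : ℚ) - tangency f) / (tangency f + 1)) : saddle ω f F q = 0 :=
  lam_eq_zero ((wtGE_diag_C _ k hF).mul (slopeLE_expTail f).wtGE) hq

theorem saddle_lead (ω : ℂ) (f : ℂ⟦X⟧) (k : ℕ) :
    saddle ω f (PowerSeries.X ^ k) (((k : ℚ) - tangency f) / (tangency f + 1)) =
      (ω ^ (k + 1))⁻¹ * ((((tangency f : ℝ) + 1) ^
        (((k : ℝ) + 1) / ((tangency f : ℝ) + 1) - 1) : ℝ) : ℂ) :=
  lam_lead ω (slopeLE_expTail f) (coeff_zero_expTail f) k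

theorem X_pow_mul_tau_pow (κ : ℕ) : (PowerSeries.X ^ κ * PowerSeries.C Polynomial.X ^ (κ + 1) *
    PowerSeries.X : ℂ[X]⟦X⟧) = diag (PowerSeries.C (PowerSeries.X ^ (κ + 1))) := by
  rw [map_pow, map_pow, diag_C_X]
  ring

theorem euler_X (β : ℂ) : euler 0 β PowerSeries.X = 0 := by
  ext N p
  rw [coeff_euler, PowerSeries.coeff_X]
  split_ifs
  · rw [Polynomial.coeff_one]
    split_ifs with h
    · simp [h]
    · simp
  · simp

/-- Multiplication by `ν` corresponds to `-∂_n`, which brings down `f*(x)` from `exp(-n f*(x))`. The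
expanded tail and the leading term of `f*` arise separately and are added at the end. -/
theorem saddle_primitive_mul {ω : ℂ} {f : ℂ⟦X⟧} (hω0 : ω ≠ 0)
    (hω : ω ^ (tangency f + 1) = PowerSeries.coeff (tangency f) f) (F : ℂ⟦X⟧) (q : ℚ) :
    saddle ω f (primitive f * F) q = saddle ω f F (q - 1) := by
  set κ := tangency f with hκ
  set V := diag (PowerSeries.C (primitiveTail f)) with hV
  set A := diag (PowerSeries.C F) * expTail f with hA
  have hAs : SlopeLE κ A := slopeLE_diag_mul_expTail f _
  -- `euler 1 (-1)` kills functions of `x`, so it sees only the explicit `τ` in the exponent of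
  -- `expTail`; this yields `f*` without its leading term.
  have h1 : PowerSeries.X * euler 1 (-1) A =
      diag (PowerSeries.C (PowerSeries.X * primitiveTail f * F)) * expTail f := by
    rw [hA, euler_mul, euler_diag_C, expTail, euler_expSharp _ _ (constantCoeff_tail f), map_neg,
      euler_mul, euler_diag_C, euler_tau]
    simp only [add_neg_cancel, zero_smul, map_zero, map_mul, diag_C_X, map_neg, map_one, ← hV]
    ring
  have h2 : PowerSeries.X * (euler 0 1 A + A) = euler 0 1 (PowerSeries.X * A) +
      PowerSeries.X * A := by
    rw [euler_mul _ _ PowerSeries.X, euler_X]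
    ring
  -- The factor required by `lam_sub_one` is `nirExponent κ N p + 1 = (N - p) + (p + 1)/(κ + 1)`.
  -- Its second part becomes `f_κ x^(κ+1)/(κ+1)` by `lam_parts`.
  have h3 : saddle ω f F (q - 1) = lam κ ω (PowerSeries.X * (euler 1 (-1) A +
      PowerSeries.C (Polynomial.C (1 / ((κ : ℂ) + 1))) * (euler 0 1 A + A))) q := by
    refine lam_sub_one κ ω A _ q fun N p => ?_
    rw [map_add, Polynomial.coeff_add, coeff_euler, PowerSeries.coeff_C_mul,
      Polynomial.coeff_C_mul, map_add, Polynomial.coeff_add, coeff_euler, nirExponent]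
    have : (κ : ℂ) + 1 ≠ 0 := by exact_mod_cast κ.succ_ne_zero
    push_cast
    field_simp
    ring
  have hs2 : SlopeLE κ (PowerSeries.C (Polynomial.C (1 / ((κ : ℂ) + 1))) *
      (euler 0 1 (PowerSeries.X * A) + PowerSeries.X * A)) := by
    rw [← diag_C_C]
    exact (slopeLE_diag _ _).mul ((((slopeLE_X κ).mul hAs).euler _ _).add ((slopeLE_X κ).mul hAs))
  rw [h3, mul_add, mul_left_comm, h2, lam_add ω ((slopeLE_X κ).mul (hAs.euler _ _)) hs2,
    lam_const_mul, lam_parts κ hω0, h1, ← mul_assoc _ PowerSeries.X A, X_pow_mul_tau_pow, hω, hA,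
    ← mul_assoc (diag _), ← map_mul, ← map_mul, primitive_eq, add_mul, saddle_add, mul_assoc
    (PowerSeries.C _), saddle_C_mul, ← hκ]
  unfold saddle
  ring

/-- Integration by parts in `x`: the factor `n` from differentiating `exp(-n f*(x))` is `∂_ν`, and
the test function `X * G` vanishes at `x = 0`, so there is no boundary term. -/
theorem saddle_derivative {ω : ℂ} {f : ℂ⟦X⟧} (hω0 : ω ≠ 0)
    (hω : ω ^ (tangency f + 1) = PowerSeries.coeff (tangency f) f) (G : ℂ⟦X⟧) (q : ℚ) :
    ((q + 1 : ℚ) : ℂ) * saddle ω f (f * (PowerSeries.X * G)) (q + 1) =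
      saddle ω f (PowerSeries.derivative ℂ (PowerSeries.X * G)) q := by
  set κ := tangency f with hκ
  set V := diag (PowerSeries.C (primitiveTail f)) with hV
  set W := diag (PowerSeries.C (PowerSeries.derivative ℂ (primitiveTail f))) with hW
  set B := PowerSeries.X * (diag (PowerSeries.C G) * expTail f) with hB
  set u := PowerSeries.derivative ℂ (PowerSeries.X * primitiveTail f) with hu
  have hf : f = u + PowerSeries.C (PowerSeries.coeff κ f) * PowerSeries.X ^ κ := by
    ext N
    have : (N : ℂ) + 1 ≠ 0 := by exact_mod_cast N.succ_ne_zero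
    rw [map_add, hu, PowerSeries.coeff_derivative, PowerSeries.coeff_succ_X_mul,
      PowerSeries.coeff_C_mul, PowerSeries.coeff_X_pow, primitiveTail, PowerSeries.coeff_mk, ← hκ]
    by_cases h : N = κ
    · simp [h]
    · simp only [h, if_false]
      field_simp
      simp
  have h1 : PowerSeries.X * (diag (PowerSeries.C (PowerSeries.derivative ℂ (PowerSeries.X * G))) *
      expTail f) = euler 0 1 B + B +
      diag (PowerSeries.C (u * (PowerSeries.X * G))) * expTail f := by
    rw [hB, hu, euler_mul, euler_X, euler_mul, euler_diag_C, expTail,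
      euler_expSharp _ _ (constantCoeff_tail f), map_neg, euler_mul, euler_diag_C, euler_tau]
    simp only [Derivation.leibniz, PowerSeries.derivative_X, smul_eq_mul, zero_add, one_smul,
      map_mul, map_add, mul_one, diag_C_X, map_one, one_mul, ← hV, ← hW]
    ring
  have hBs : SlopeLE κ B := (slopeLE_X κ).mul (slopeLE_diag_mul_expTail f _)
  have key : saddle ω f (f * (PowerSeries.X * G)) (q + 1) = lam κ ω (PowerSeries.X *
      (diag (PowerSeries.C (PowerSeries.derivative ℂ (PowerSeries.X * G))) * expTail f))
        (q + 1) := by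
    rw [h1, lam_add ω ((hBs.euler _ _).add hBs) (slopeLE_diag_mul_expTail f _),
      lam_parts κ hω0, hB, ← mul_assoc _ PowerSeries.X (_ * _), X_pow_mul_tau_pow, hω,
      ← mul_assoc (diag _), ← map_mul, ← map_mul]
    conv_lhs => rw [hf]
    rw [add_mul, saddle_add, mul_assoc (PowerSeries.C _), saddle_C_mul, ← mul_assoc (_ ^ κ),
      ← pow_succ, add_comm, ← hf]
    rfl
  rw [key, lam_X_mul]
  rfl

/-! ### Derivation and evaluation of ramified series -/

/-- All exponents of `a` are `≥ b`. -/
def OrdGE (b : ℚ) (a : RamSeries) : Prop := ∀ q < b, a.coeff q = 0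

theorem OrdGE.mono {b c : ℚ} {a : RamSeries} (h : OrdGE b a) (hc : c ≤ b) : OrdGE c a :=
  fun q hq => h q (hq.trans_le hc)

theorem OrdGE.mul {b c : ℚ} {x y : RamSeries} (hx : OrdGE b x) (hy : OrdGE c y) :
    OrdGE (b + c) (x * y) := by
  intro q hq
  rw [HahnSeries.coeff_mul]
  refine Finset.sum_eq_zero fun i hi => ?_
  obtain ⟨h1, h2, h3⟩ := Finset.mem_antidiagonal.1 hi
  rcases lt_or_ge i.1 b with h | h
  · exact absurd (hx _ h) h1
  · exact absurd (hy i.2 (by linarith)) h2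

theorem OrdGE.sub {b : ℚ} {x y : RamSeries} (hx : OrdGE b x) (hy : OrdGE b y) :
    OrdGE b (x - y) := by
  intro q hq
  rw [HahnSeries.coeff_sub, hx q hq, hy q hq, sub_zero]

theorem OrdGE.coeff_mul {b c : ℚ} {x y : RamSeries} (hx : OrdGE b x) (hy : OrdGE c y) :
    (x * y).coeff (b + c) = x.coeff b * y.coeff c := by
  rw [HahnSeries.coeff_mul, Finset.sum_eq_single (b, c)]
  · rintro ⟨i, j⟩ hi hne
    obtain ⟨h1, h2, h3⟩ := Finset.mem_antidiagonal.1 hi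
    simp only at h3 h1 h2 ⊢
    rcases lt_trichotomy i b with h | h | h
    · exact absurd (hx _ h) h1
    · exact absurd (by rw [h] at h3 ⊢; simpa using h3) hne
    · exact absurd (hy j (by linarith)) h2
  · intro hn
    by_contra h
    exact hn (Finset.mem_antidiagonal.2 ⟨left_ne_zero_of_mul h, right_ne_zero_of_mul h, rfl⟩)

theorem ordGE_one : OrdGE 0 (1 : RamSeries) := by
  intro q hq
  rw [HahnSeries.coeff_one, if_neg hq.ne]

theorem OrdGE.pow {b : ℚ} {x : RamSeries} (hx : OrdGE b x) (n : ℕ) : OrdGE (n * b) (x ^ n) := by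
  induction n with
  | zero => simpa using ordGE_one
  | succ n ih =>
    rw [pow_succ]
    convert ih.mul hx using 1
    push_cast
    ring

theorem OrdGE.coeff_pow {b : ℚ} {x : RamSeries} (hx : OrdGE b x) (n : ℕ) :
    (x ^ n).coeff (n * b) = x.coeff b ^ n := by
  induction n with
  | zero => simp
  | succ n ih =>
    rw [pow_succ, pow_succ, ← ih, ← (hx.pow n).coeff_mul hx]
    congr 1
    push_cast
    ring

theorem OrdGE.dNu {b : ℚ} {x : RamSeries} (hx : OrdGE b x) : OrdGE (b - 1) (dNu x) := by
  intro q hq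
  change ((q + 1 : ℚ) : ℂ) * x.coeff (q + 1) = 0
  rw [hx _ (by linarith), mul_zero]

/-- The derivation `ν ∂_ν`. -/
noncomputable def eulerNu (a : RamSeries) : RamSeries where
  coeff q := (q : ℂ) * a.coeff q
  isPWO_support' := a.isPWO_support.mono fun _ hq => right_ne_zero_of_mul hq

theorem dNu_eq (a : RamSeries) : dNu a = HahnSeries.single (-1 : ℚ) (1 : ℂ) * eulerNu a := by
  ext q
  have := HahnSeries.coeff_single_mul_add (r := (1 : ℂ)) (x := eulerNu a) (a := q + 1)
    (b := (-1 : ℚ))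
  rw [add_neg_cancel_right, one_mul] at this
  rw [this]
  rfl

theorem eulerNu_mul (a b : RamSeries) : eulerNu (a * b) = a * eulerNu b + b * eulerNu a := by
  ext q
  change (q : ℂ) * (a * b).coeff q = _
  have ha : (eulerNu a).support ⊆ a.support := fun _ hq => right_ne_zero_of_mul hq
  have hb : (eulerNu b).support ⊆ b.support := fun _ hq => right_ne_zero_of_mul hq
  rw [HahnSeries.coeff_add, mul_comm b, HahnSeries.coeff_mul,
    HahnSeries.coeff_mul_right' b.isPWO_support hb, HahnSeries.coeff_mul_left' a.isPWO_support ha,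
    Finset.mul_sum, ← Finset.sum_add_distrib]
  refine Finset.sum_congr rfl fun i hi => ?_
  obtain ⟨h1, h2, h3⟩ := Finset.mem_antidiagonal.1 hi
  change _ = a.coeff i.1 * ((i.2 : ℂ) * b.coeff i.2) + ((i.1 : ℂ) * a.coeff i.1) * b.coeff i.2
  rw [← h3]
  push_cast
  ring

theorem dNu_mul (a b : RamSeries) : dNu (a * b) = a * dNu b + b * dNu a := by
  rw [dNu_eq, dNu_eq, dNu_eq, eulerNu_mul]
  ring

theorem dNu_add (a b : RamSeries) : dNu (a + b) = dNu a + dNu b := by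
  ext q
  change ((q + 1 : ℚ) : ℂ) * (a.coeff (q + 1) + b.coeff (q + 1)) =
    ((q + 1 : ℚ) : ℂ) * a.coeff (q + 1) + ((q + 1 : ℚ) : ℂ) * b.coeff (q + 1)
  ring

theorem dNu_single_zero (c : ℂ) : dNu (HahnSeries.single 0 c) = 0 := by
  ext q
  change ((q + 1 : ℚ) : ℂ) * (HahnSeries.single (0 : ℚ) c).coeff (q + 1) = 0
  by_cases h : q + 1 = 0
  · rw [h]; simp
  · rw [HahnSeries.coeff_single_of_ne h, mul_zero]

theorem dNu_single_one : dNu (HahnSeries.single 1 1) = 1 := by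
  ext q
  change ((q + 1 : ℚ) : ℂ) * (HahnSeries.single (1 : ℚ) (1 : ℂ)).coeff (q + 1) = _
  rw [HahnSeries.coeff_one, HahnSeries.coeff_single]
  by_cases h : q = 0
  · simp [h]
  · simp [h]

/-! ### Evaluation of power series at a ramified series. -/

theorem heval_C_eq_single (y : RamSeries) (c : ℂ) :
    PowerSeries.heval y (PowerSeries.C c) = HahnSeries.single 0 c := by
  rw [PowerSeries.heval_C]
  ext q
  rw [HahnSeries.coeff_smul, HahnSeries.coeff_one, HahnSeries.coeff_single]
  split_ifs <;> simp

theorem ordGE_heval {y : RamSeries} (hy0 : 0 < y.orderTop) {b : ℚ} (hb : 0 ≤ b) (hy : OrdGE b y)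
    (F : ℂ⟦X⟧) : OrdGE 0 (PowerSeries.heval y F) := by
  intro q hq
  rw [PowerSeries.coeff_heval]
  refine finsum_eq_zero_of_forall_eq_zero fun n => ?_
  change (HahnSeries.SummableFamily.powerSeriesFamily y F n).coeff q = 0
  rw [HahnSeries.SummableFamily.powerSeriesFamily_of_orderTop_pos hy0, HahnSeries.coeff_smul,
    hy.pow n q (lt_of_lt_of_le hq (by positivity)), smul_zero]

theorem ordGE_heval_of_dvd {y : RamSeries} (hy0 : 0 < y.orderTop) {b : ℚ} (hb : 0 ≤ b)
    (hy : OrdGE b y) {F : ℂ⟦X⟧} {k : ℕ} (hF : PowerSeries.X ^ k ∣ F) :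
    OrdGE (k * b) (PowerSeries.heval y F) := by
  obtain ⟨G, rfl⟩ := hF
  rw [map_mul, map_pow, PowerSeries.heval_X y hy0]
  simpa using (hy.pow k).mul (ordGE_heval hy0 hb hy G)

/-- The chain rule. -/
theorem dNu_heval {y : RamSeries} (hy0 : 0 < y.orderTop) {b : ℚ} (hb : 0 < b) (hy : OrdGE b y)
    (F : ℂ⟦X⟧) :
    dNu (PowerSeries.heval y F) = PowerSeries.heval y (PowerSeries.derivative ℂ F) * dNu y := by
  -- Writing `F = c + X G`, the defect of the chain rule for `F` is `y` times that for `G`.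
  -- Iteration raises its order beyond every bound because `b > 0`.
  have key : ∀ (k : ℕ) (F : ℂ⟦X⟧), OrdGE (k * b - 1) (dNu (PowerSeries.heval y F) -
      PowerSeries.heval y (PowerSeries.derivative ℂ F) * dNu y) := by
    intro k
    induction k with
    | zero =>
      intro F
      refine OrdGE.sub ?_ ?_
      · simpa using (ordGE_heval hy0 hb.le hy F).dNu
      · exact ((ordGE_heval hy0 hb.le hy _).mul hy.dNu).mono (by push_cast; linarith)
    | succ k ih =>
      intro F
      obtain ⟨G, hG⟩ : PowerSeries.X ∣ F - PowerSeries.C (PowerSeries.constantCoeff F) :=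
        PowerSeries.X_dvd_iff.2 (by simp)
      rw [sub_eq_iff_eq_add] at hG
      have : dNu (PowerSeries.heval y F) -
          PowerSeries.heval y (PowerSeries.derivative ℂ F) * dNu y =
          y * (dNu (PowerSeries.heval y G) -
            PowerSeries.heval y (PowerSeries.derivative ℂ G) * dNu y) := by
        rw [hG]
        simp only [map_add, map_mul, PowerSeries.heval_X y hy0, heval_C_eq_single, dNu_add, dNu_mul,
          dNu_single_zero, Derivation.leibniz, PowerSeries.derivative_X, PowerSeries.derivative_C,
          smul_eq_mul, mul_one, add_zero]
        ring
      rw [this]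
      refine (hy.mul (ih G)).mono ?_
      push_cast
      linarith
  rw [← sub_eq_zero]
  ext q
  obtain ⟨k, hk⟩ := exists_nat_gt ((q + 1) / b)
  rw [div_lt_iff₀ hb] at hk
  exact key k F q (by linarith)

/-! ### The reciprocal series -/

variable {f : ℂ⟦X⟧} {ω : ℂ} {y : RamSeries}

theorem coeff_tangency_ne_zero (hf : f ≠ 0) : PowerSeries.coeff (tangency f) f ≠ 0 :=
  PowerSeries.coeff_order hf

/-- Here `f* = X^(κ+1) U` with `U(0) ≠ 0`, and evaluating `U` gives a series of order `0`; so `(κ+1)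
· ord y = ord ν = 1`. -/
theorem ordGE_reciprocal (hf : f ≠ 0) (hy0 : 0 < y.orderTop)
    (hy : PowerSeries.heval y (primitive f) = HahnSeries.single (1 : ℚ) (1 : ℂ)) :
    OrdGE (1 / ((tangency f : ℚ) + 1)) y := by
  set κ := tangency f with hκ
  obtain ⟨U, hU⟩ : PowerSeries.X ^ (κ + 1) ∣ primitive f := by
    rw [PowerSeries.X_pow_dvd_iff]
    intro N hN
    rw [primitive, PowerSeries.coeff_mk]
    split_ifs with h
    · rfl
    · rw [coeff_eq_zero_of_lt_tangency (by omega), zero_div]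
  have hU0 : PowerSeries.constantCoeff U ≠ 0 := by
    have h1 : PowerSeries.coeff (κ + 1) (primitive f) = PowerSeries.constantCoeff U := by
      rw [hU, ← PowerSeries.coeff_zero_eq_constantCoeff_apply]
      simpa using PowerSeries.coeff_X_pow_mul U (κ + 1) 0
    rw [← h1, primitive, PowerSeries.coeff_mk, if_neg κ.succ_ne_zero]
    exact div_ne_zero (coeff_tangency_ne_zero hf) (by exact_mod_cast κ.succ_ne_zero)
  rw [hU, map_mul, map_pow, PowerSeries.heval_X y hy0] at hy
  have hs : (HahnSeries.single (1 : ℚ) (1 : ℂ)) ≠ 0 := HahnSeries.single_ne_zero one_ne_zero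
  have hne : y ^ (κ + 1) * PowerSeries.heval y U ≠ 0 := by rw [hy]; exact hs
  have hyp := left_ne_zero_of_mul hne
  have hun := right_ne_zero_of_mul hne
  have hy1 : y ≠ 0 := by rintro rfl; simp at hyp
  have hpos : 0 ≤ y.order := HahnSeries.zero_le_orderTop_iff.1 hy0.le
  have hyo : OrdGE y.order y := fun q hq => HahnSeries.coeff_eq_zero_of_lt_order hq
  have hUo : (PowerSeries.heval y U).order = 0 := by
    refine le_antisymm (HahnSeries.order_le_of_coeff_ne_zero ?_) ?_
    · rw [PowerSeries.coeff_heval_zero]; exact hU0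
    · by_contra hlt
      exact HahnSeries.coeff_order_eq_zero.not.2 hun
        (ordGE_heval hy0 hpos hyo U _ (not_le.1 hlt))
  have ho := congrArg HahnSeries.order hy
  rw [HahnSeries.order_mul hyp hun, HahnSeries.order_pow, hUo, add_zero,
    HahnSeries.order_single one_ne_zero, nsmul_eq_mul] at ho
  have : y.order = 1 / ((κ : ℚ) + 1) := by
    have : (κ : ℚ) + 1 ≠ 0 := by positivity
    push_cast at ho
    field_simp
    linarith
  rwa [this] at hyo

theorem heval_mul_dNu (hf : f ≠ 0) (hy0 : 0 < y.orderTop)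
    (hy : PowerSeries.heval y (primitive f) = HahnSeries.single (1 : ℚ) (1 : ℂ)) :
    PowerSeries.heval y f * dNu y = 1 := by
  rw [← dNu_single_one, ← hy, dNu_heval hy0 (by positivity) (ordGE_reciprocal hf hy0 hy),
    derivative_primitive]

/-- The terms `f_κ x^(κ+1)` cancel. This near-homogeneity of `f*` drives the induction in
`saddle_eq`. -/
theorem X_pow_dvd_primitive_sub (f : ℂ⟦X⟧) : PowerSeries.X ^ (tangency f + 2) ∣
    PowerSeries.C ((tangency f : ℂ) + 1) * primitive f - f * PowerSeries.X := by
  rw [PowerSeries.X_pow_dvd_iff]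
  intro N hN
  rw [map_sub, PowerSeries.coeff_C_mul, primitive, PowerSeries.coeff_mk]
  cases N with
  | zero => simp
  | succ m =>
    rw [PowerSeries.coeff_succ_mul_X, if_neg m.succ_ne_zero, Nat.add_sub_cancel]
    by_cases h : m = tangency f
    · have : (m : ℂ) + 1 ≠ 0 := by exact_mod_cast m.succ_ne_zero
      rw [← h]
      push_cast
      field_simp
      ring
    · rw [coeff_eq_zero_of_lt_tangency (by omega)]
      simp

/-- The saddle point integral of `F` is the pull-back `F(g*) ∂_ν g*`. -/
theorem saddle_eq (hf : f ≠ 0) (hω : ω ^ (tangency f + 1) = PowerSeries.coeff (tangency f) f)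
    (hy0 : 0 < y.orderTop)
    (hy : PowerSeries.heval y (primitive f) = HahnSeries.single (1 : ℚ) (1 : ℂ))
    (hlead : y.coeff (1 / ((tangency f : ℚ) + 1)) =
      ((((tangency f : ℝ) + 1) ^ (1 / ((tangency f : ℝ) + 1)) : ℝ) : ℂ) / ω) (F : ℂ⟦X⟧) (q : ℚ) :
    saddle ω f F q = (PowerSeries.heval y F * dNu y).coeff q := by
  set κ := tangency f with hκ
  have hω0 : ω ≠ 0 := by
    rintro rfl
    rw [zero_pow κ.succ_ne_zero] at hω
    exact coeff_tangency_ne_zero hf hω.symm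
  have hD : (κ : ℚ) + 1 ≠ 0 := by positivity
  have hD0 : (0 : ℚ) < (κ : ℚ) + 1 := by positivity
  have hyo := ordGE_reciprocal hf hy0 hy
  rw [← hκ] at hyo
  have hyo0 : (0 : ℚ) < 1 / ((κ : ℚ) + 1) := by positivity
  -- The defect `Δ` inherits linearity and the two rules; it remains to show that these and the
  -- leading terms force it to vanish.
  let Δ : ℂ⟦X⟧ → ℚ → ℂ := fun F q => saddle ω f F q - (PowerSeries.heval y F * dNu y).coeff q
  have hadd : ∀ F G q, Δ (F + G) q = Δ F q + Δ G q := by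
    intro F G q
    simp only [Δ, saddle_add, map_add, add_mul, HahnSeries.coeff_add]
    ring
  have hC : ∀ c F q, Δ (PowerSeries.C c * F) q = c * Δ F q := by
    intro c F q
    simp only [Δ]
    rw [saddle_C_mul, map_mul, heval_C_eq_single, mul_assoc, HahnSeries.coeff_single_zero_mul,
      mul_sub]
  have hmul : ∀ F q, Δ (primitive f * F) (q + 1) = Δ F q := by
    intro F q
    simp only [Δ]
    rw [saddle_primitive_mul hω0 hω, add_sub_cancel_right, map_mul, hy, mul_assoc,
      HahnSeries.coeff_single_mul_add, one_mul]
  have hder : ∀ G q, ((q + 1 : ℚ) : ℂ) * Δ (f * (PowerSeries.X * G)) (q + 1) =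
      Δ (PowerSeries.derivative ℂ (PowerSeries.X * G)) q := by
    intro G q
    simp only [Δ]
    rw [mul_sub, saddle_derivative hω0 hω, ← dNu_heval hy0 hyo0 hyo, map_mul _ f, mul_right_comm,
      heval_mul_dNu hf hy0 hy, one_mul]
    rfl
  have hlow : ∀ (k : ℕ) (F : ℂ⟦X⟧), PowerSeries.X ^ k ∣ F →
      ∀ q : ℚ, q < ((k : ℚ) - κ) / (κ + 1) → Δ F q = 0 := by
    intro k F hF q hq
    have h2 : (k : ℚ) * (1 / ((κ : ℚ) + 1)) + (1 / ((κ : ℚ) + 1) - 1) =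
        ((k : ℚ) - κ) / (κ + 1) := by field_simp; ring
    simp only [Δ]
    rw [saddle_eq_zero ω f hF hq,
      ((ordGE_heval_of_dvd hy0 hyo0.le hyo hF).mul hyo.dNu) q (by rw [h2]; exact hq), sub_zero]
  -- The leading coefficient of `g*` enters here: it must be taken for the same determination `ω` as
  -- the Laplace constants.
  have hfirst : ∀ k : ℕ, Δ (PowerSeries.X ^ k) (((k : ℚ) - κ) / (κ + 1)) = 0 := by
    intro k
    have h2 : ((k : ℚ) - κ) / (κ + 1) = (k : ℚ) * (1 / ((κ : ℚ) + 1)) + (1 / ((κ : ℚ) + 1) - 1) :=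
      by field_simp; ring
    have h3 : (dNu y).coeff (1 / ((κ : ℚ) + 1) - 1) =
        1 / ((κ : ℂ) + 1) * y.coeff (1 / ((κ : ℚ) + 1)) := by
      change ((1 / ((κ : ℚ) + 1) - 1 + 1 : ℚ) : ℂ) * y.coeff (1 / ((κ : ℚ) + 1) - 1 + 1) = _
      rw [sub_add_cancel]
      push_cast
      rfl
    simp only [Δ]
    rw [saddle_lead, ← hκ, h2, map_pow, PowerSeries.heval_X y hy0, (hyo.pow k).coeff_mul hyo.dNu,
      hyo.coeff_pow, h3, hlead]
    have hR : (0 : ℝ) < (κ : ℝ) + 1 := by positivity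
    have h4 : ((κ : ℝ) + 1) ^ (((k : ℝ) + 1) / ((κ : ℝ) + 1) - 1) =
        (((κ : ℝ) + 1) ^ (1 / ((κ : ℝ) + 1))) ^ (k + 1) / ((κ : ℝ) + 1) := by
      rw [Real.rpow_sub_one hR.ne', ← Real.rpow_natCast, ← Real.rpow_mul hR.le]
      congr 2
      push_cast
      ring
    rw [h4, sub_eq_zero]
    have h5 : (κ : ℂ) + 1 ≠ 0 := by exact_mod_cast κ.succ_ne_zero
    generalize ((κ : ℝ) + 1) ^ (1 / ((κ : ℝ) + 1)) = t
    rw [div_pow]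
    push_cast
    field_simp
    ring
  -- `j` counts the steps of size `1/(κ+1)` gained beyond the trivial order bound for multiples of
  -- `X ^ k`.
  have key : ∀ (j k : ℕ) (F : ℂ⟦X⟧), PowerSeries.X ^ k ∣ F →
      ∀ q : ℚ, q < ((k : ℚ) + j - κ) / (κ + 1) → Δ F q = 0 := by
    intro j
    induction j with
    | zero => intro k F hF q hq; exact hlow k F hF q (by simpa using hq)
    | succ j ih =>
      intro k F hF q hq
      have hX : Δ (PowerSeries.X ^ k) q = 0 := by
        -- The remainder gains `κ + 2` powers of `X` while the exponent only rises by `1`, that is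
        -- by `κ + 1` steps; the spare step makes level `j` of the induction sufficient.
        have hR := ih (k + (κ + 2)) (PowerSeries.X ^ k *
          (PowerSeries.C ((κ : ℂ) + 1) * primitive f - f * PowerSeries.X))
          (by rw [pow_add]; exact mul_dvd_mul_left _ (X_pow_dvd_primitive_sub f)) (q + 1) (by
            rw [← lt_sub_iff_add_lt]
            refine hq.trans_eq ?_
            push_cast
            field_simp
            ring)
        have hsplit : PowerSeries.C ((κ : ℂ) + 1) * (primitive f * PowerSeries.X ^ k) =
            PowerSeries.X ^ k * (PowerSeries.C ((κ : ℂ) + 1) * primitive f - f * PowerSeries.X) +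
            f * (PowerSeries.X * PowerSeries.X ^ k) := by ring
        have h1 := congrArg (fun G => Δ G (q + 1)) hsplit
        simp only [hadd, hC, hmul, hR, zero_add] at h1
        have h2 := hder (PowerSeries.X ^ k) q
        rw [← h1, ← pow_succ', PowerSeries.derivative_pow, PowerSeries.derivative_X, mul_one,
          Nat.add_sub_cancel, ← map_natCast (PowerSeries.C (R := ℂ)), hC] at h2
        -- Modulo the remainder, `(κ+1) Δ(x^k)(q) = Δ(f x^(k+1))(q+1)`, and integration by parts
        -- multiplies this by `q + 1` to give `(k+1) Δ(x^k)(q)`. The factor vanishes only at the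
        -- leading exponent, covered by `hfirst`.
        have h3 : (((κ : ℂ) + 1) * ((q + 1 : ℚ) : ℂ) - ((k + 1 : ℕ) : ℂ)) *
            Δ (PowerSeries.X ^ k) q = 0 := by
          rw [sub_mul, ← h2]
          ring
        rcases mul_eq_zero.1 h3 with h | h
        · have h4 : ((κ : ℚ) + 1) * (q + 1) - ((k + 1 : ℕ) : ℚ) = 0 := by exact_mod_cast h
          have h5 : q = ((k : ℚ) - κ) / (κ + 1) := by
            push_cast at h4
            field_simp
            linarith
          rw [h5]
          exact hfirst k
        · exact h
      obtain ⟨G, rfl⟩ := hF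
      obtain ⟨G', hG⟩ : PowerSeries.X ∣ G - PowerSeries.C (PowerSeries.constantCoeff G) :=
        PowerSeries.X_dvd_iff.2 (by simp)
      have hsplit : PowerSeries.X ^ k * G = PowerSeries.C (PowerSeries.constantCoeff G) *
          PowerSeries.X ^ k + PowerSeries.X ^ (k + 1) * G' := by
        rw [pow_succ, mul_assoc, ← hG]
        ring
      rw [hsplit, hadd, hC, hX, mul_zero, zero_add]
      refine ih (k + 1) _ (dvd_mul_right _ _) q (hq.trans_eq ?_)
      push_cast
      ring
  rw [← sub_eq_zero]
  obtain ⟨j, hj⟩ := exists_nat_gt (q * ((κ : ℚ) + 1) + κ)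
  refine key j 0 F (by simp) q ?_
  rw [lt_div_iff₀ hD0]
  push_cast
  linarith

/-! ### Iterated integrals and the final summation -/

theorem lam_X_pow_mul (ω : ℂ) (f P : ℂ⟦X⟧) {a : RamSeries}
    (ha : ∀ q, saddle ω f P q = a.coeff q) (r : ℕ) (q : ℚ) :
    lam (tangency f) ω (PowerSeries.X ^ r * (diag (PowerSeries.C P) * expTail f)) q =
      (intNu^[r] a).coeff q := by
  induction r generalizing q with
  | zero => rw [pow_zero, one_mul]; exact ha q
  | succ r ih =>
    rw [Function.iterate_succ_apply']
    change _ = (intNu^[r] a).coeff (q - 1) / (q : ℂ)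
    rw [← ih]
    -- `intNu` divides by zero at exponent `0` and returns `0`. The left side agrees, since its
    -- weight `≥ (κ+1)(r+1)` forces positive exponents.
    by_cases hq : q = 0
    · rw [hq, Rat.cast_zero, div_zero]
      refine lam_eq_zero ((wtGE_X_pow _ (r + 1)).mul (slopeLE_diag_mul_expTail f _).wtGE) ?_
      have : (0 : ℚ) ≤ (tangency f : ℚ) := by positivity
      have : (0 : ℚ) ≤ (r : ℚ) := by positivity
      refine div_pos ?_ (by positivity)
      push_cast
      nlinarith
    · have hq' : (q : ℂ) ≠ 0 := by exact_mod_cast hq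
      have := lam_X_mul (tangency f) ω
        (PowerSeries.X ^ r * (diag (PowerSeries.C P) * expTail f)) (q - 1)
      rw [sub_add_cancel, ← mul_assoc, ← pow_succ'] at this
      rw [← this, mul_div_cancel_left₀ _ hq']

theorem coeff_nir (ω : ℂ) (f : ℂ⟦X⟧) (q : ℚ) :
    (nir ω f).coeff q = lam (tangency f) ω (expSharp (-fUp f)) q := by
  rw [nir, HahnSeries.SummableFamily.coeff_hsum, lam]
  refine finsum_congr fun i => ?_
  change (nirTerm ω f i).coeff q = _
  rw [nirTerm, HahnSeries.coeff_single, kern]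
  simp only [eq_comm (a := q), mul_div_assoc]

/-- The coefficient at the lowest exponent `-κ/(κ+1)` is `ω⁻¹` times a positive real. -/
theorem nir_ne_zero (hf : f ≠ 0) (hω : ω ^ (tangency f + 1) = PowerSeries.coeff (tangency f) f) :
    nir ω f ≠ 0 := by
  intro h
  have hω0 : ω ≠ 0 := by
    rintro rfl
    rw [zero_pow (Nat.succ_ne_zero _)] at hω
    exact coeff_tangency_ne_zero hf hω.symm
  have hlead := lam_lead (κ := tangency f) ω
    ((slopeLE_neg_fUp f).expSharp (constantCoeff_neg_fUp f))
    (by rw [PowerSeries.coeff_zero_eq_constantCoeff_apply,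
      constantCoeff_expSharp (constantCoeff_neg_fUp f), Polynomial.coeff_one_zero]) 0
  rw [pow_zero, map_one, map_one, one_mul, ← coeff_nir, h, HahnSeries.coeff_zero] at hlead
  refine mul_ne_zero (inv_ne_zero (pow_ne_zero _ hω0)) ?_ hlead.symm
  exact_mod_cast (Real.rpow_pos_of_pos (by positivity : (0 : ℝ) < (tangency f : ℝ) + 1) _).ne'

theorem X_pow_dvd_sub_sum {R : Type*} [CommRing R] (c : R⟦X⟧) (M : ℕ) :
    (PowerSeries.X : R⟦X⟧) ^ M ∣ c - ∑ r ∈ Finset.range M,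
      PowerSeries.X ^ r * PowerSeries.C (PowerSeries.coeff r c) := by
  rw [PowerSeries.X_pow_dvd_iff]
  intro N hN
  rw [map_sub, map_sum, Finset.sum_eq_single N]
  · rw [PowerSeries.coeff_mul_C, PowerSeries.coeff_X_pow_self, one_mul, sub_self]
  · intro r _ hr
    rw [PowerSeries.coeff_mul_C, PowerSeries.coeff_X_pow, if_neg (Ne.symm hr), zero_mul]
  · intro h
    exact absurd (Finset.mem_range.2 hN) h

theorem exists_diag_eq (c : ℂ⟦X⟧⟦X⟧) (M : ℕ) : ∃ c' : ℂ⟦X⟧⟦X⟧,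
    diag c = PowerSeries.X ^ M * diag c' +
      ∑ r ∈ Finset.range M, PowerSeries.X ^ r * diag (PowerSeries.C (PowerSeries.coeff r c)) := by
  obtain ⟨c', hc'⟩ := X_pow_dvd_sub_sum c M
  refine ⟨c', ?_⟩
  have h := congrArg diag (sub_eq_iff_eq_add.1 hc')
  have h1 : ∀ (r : ℕ) (d : ℂ⟦X⟧⟦X⟧),
      diag (PowerSeries.X ^ r * d) = PowerSeries.X ^ r * diag d := by
    intro r d
    rw [RingHom.map_mul, RingHom.map_pow, diag_X]
  rw [RingHom.map_add, h1, map_sum] at h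
  simp only [h1] at h
  exact h

theorem lam_sum {κ : ℕ} (ω : ℂ) {a : ℕ → ℂ[X]⟦X⟧} (ha : ∀ r, SlopeLE κ (a r)) (q : ℚ) (M : ℕ) :
    SlopeLE κ (∑ r ∈ Finset.range M, a r) ∧
      lam κ ω (∑ r ∈ Finset.range M, a r) q = ∑ r ∈ Finset.range M, lam κ ω (a r) q := by
  induction M with
  | zero => exact ⟨fun N p h => absurd (by simp) h, by simp [lam]⟩
  | succ M ih =>
    rw [Finset.sum_range_succ, Finset.sum_range_succ]
    exact ⟨ih.1.add (ha M), by rw [lam_add ω ih.1 (ha M), ih.2]⟩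

/-- `lam` is only finitely additive, so the expansion in `I` is cut at order `M`: a factor `X ^ M`
pushes the exponents beyond `q`. -/
theorem lam_diag_mul_expTail (ω : ℂ) (f : ℂ⟦X⟧) (c : ℂ⟦X⟧⟦X⟧) (q : ℚ) :
    lam (tangency f) ω (expTail f * diag c) q = ∑ᶠ r : ℕ, lam (tangency f) ω
      (PowerSeries.X ^ r * (diag (PowerSeries.C (PowerSeries.coeff r c)) * expTail f)) q := by
  obtain ⟨M, hM⟩ := exists_nat_gt (q * ((tangency f : ℚ) + 1) + tangency f)
  have hsmall : ∀ (r : ℕ) (a : ℂ[X]⟦X⟧), M ≤ r → SlopeLE (tangency f) a →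
      lam (tangency f) ω (PowerSeries.X ^ r * a) q = 0 := by
    intro r a hr ha
    refine lam_eq_zero ((wtGE_X_pow _ r).mul ha.wtGE) ?_
    rw [lt_div_iff₀ (by positivity)]
    have h1 : (M : ℚ) ≤ r := by exact_mod_cast hr
    have h2 : (0 : ℚ) ≤ tangency f * r := by positivity
    push_cast
    linarith
  have hs : ∀ (r : ℕ) (d : ℂ⟦X⟧⟦X⟧),
      SlopeLE (tangency f) (PowerSeries.X ^ r * (diag d * expTail f)) :=
    fun r d => ((slopeLE_X _).pow r).mul (slopeLE_diag_mul_expTail f d)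
  rw [finsum_eq_sum_of_support_subset (s := Finset.range M)]
  · obtain ⟨c', hc'⟩ := exists_diag_eq c M
    have hsum := lam_sum ω (fun r => hs r (PowerSeries.C (PowerSeries.coeff r c))) q M
    have hsplit : expTail f * diag c = PowerSeries.X ^ M * (diag c' * expTail f) +
        ∑ r ∈ Finset.range M, PowerSeries.X ^ r *
          (diag (PowerSeries.C (PowerSeries.coeff r c)) * expTail f) := by
      rw [hc', mul_comm, add_mul, Finset.sum_mul]
      simp only [mul_assoc]
    rw [hsplit, lam_add ω (hs _ _) hsum.1, hsum.2,
      hsmall M _ le_rfl (slopeLE_diag_mul_expTail f _), zero_add]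
  · intro r hr
    rw [Finset.coe_range, Set.mem_Iio]
    by_contra hlt
    exact hr (hsmall r _ (not_lt.1 hlt) (slopeLE_diag_mul_expTail f _))

/-! ### The bracket as a pull-back along the reciprocal series. -/

theorem block_eq (hf : f ≠ 0) (hy0 : 0 < y.orderTop)
    (hy : PowerSeries.heval y (primitive f) = HahnSeries.single (1 : ℚ) (1 : ℂ)) (r : ℕ) :
    block (dNu y)⁻¹ r =
      PowerSeries.heval y ((fun F => PowerSeries.derivative ℂ F)^[r] f) := by
  have h1 := heval_mul_dNu hf hy0 hy
  have h2 : (dNu y)⁻¹ = PowerSeries.heval y f := inv_eq_of_mul_eq_one_left h1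
  rw [block, h2]
  induction r with
  | zero => rfl
  | succ r ih =>
    rw [Function.iterate_succ_apply', Function.iterate_succ_apply', ih,
      dNu_heval hy0 (by positivity) (ordGE_reciprocal hf hy0 hy), mul_left_comm, h1, mul_one]

/-- Evaluation at `g*`, applied to each coefficient in `I`, is a ring homomorphism fixing `I`, so it
passes through `expSharp`; the prefactor `1/ḡ` is `∂_ν g*`. -/
theorem coeff_bracket (hf : f ≠ 0) (hy0 : 0 < y.orderTop)
    (hy : PowerSeries.heval y (primitive f) = HahnSeries.single (1 : ℚ) (1 : ℂ)) (r : ℕ) :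
    PowerSeries.coeff r (bracket (dNu y)⁻¹) =
      PowerSeries.heval y (PowerSeries.coeff r (expSharp (derivativePart f))) * dNu y := by
  have h1 : -PowerSeries.mk (fun r => if r = 0 then 0 else beta (r : ℤ) • block (dNu y)⁻¹ r) =
      PowerSeries.map (PowerSeries.heval y : ℂ⟦X⟧ →+* RamSeries) (derivativePart f) := by
    ext1 r
    rw [derivativePart, map_neg, map_neg, map_neg, PowerSeries.coeff_mk, PowerSeries.coeff_map,
      PowerSeries.coeff_mk]
    split_ifs
    · rw [map_zero]
    · rw [block_eq hf hy0 hy, RingHom.coe_coe, map_smul]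
  rw [bracket, inv_inv, PowerSeries.coeff_C_mul, h1,
    ← map_expSharp _ (by rw [PowerSeries.map_X]) (constantCoeff_derivativePart f),
    PowerSeries.coeff_map, mul_comm]
  rfl

end Mir

/-! ### Summability and the formula for `mir`. -/

theorem mainTheorem1 (gbar hbar : Mir.RamSeries) (hmir : Mir.IsMir gbar hbar) :
    hbar ≠ 0 ∧
    -- the coefficient of each `I ^ r` can be integrated from `0`
    (∀ r : ℕ, ∀ q ∈ (PowerSeries.coeff r (Mir.bracket gbar)).support, -1 < q) ∧
    -- replacing each `I ^ r` by `r` successive integrations from `0` gives a summable family,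
    -- whose sum is `1 / hbar`
    ∃ S : HahnSeries.SummableFamily ℚ ℂ ℕ,
      (∀ r : ℕ, S r = Mir.intNu^[r] (PowerSeries.coeff r (Mir.bracket gbar))) ∧
      1 / hbar = S.hsum := by
  obtain ⟨f, ω, y, hf, hω, hy0, hy, hlead, rfl, rfl⟩ := hmir
  have hD : (0 : ℚ) < (Mir.tangency f : ℚ) + 1 := by positivity
  have hyo := Mir.ordGE_reciprocal hf hy0 hy
  have hS : ∀ r q, (Mir.intNu^[r] (PowerSeries.coeff r (Mir.bracket (Mir.dNu y)⁻¹))).coeff q =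
      Mir.lam (Mir.tangency f) ω (PowerSeries.X ^ r * (Mir.diag (PowerSeries.C
        (PowerSeries.coeff r (Mir.expSharp (Mir.derivativePart f)))) * Mir.expTail f)) q := by
    intro r q
    rw [Mir.coeff_bracket hf hy0 hy]
    exact (Mir.lam_X_pow_mul ω f _ (Mir.saddle_eq hf hω hy0 hy hlead _) r q).symm
  -- All exponents lie in one arithmetic progression, bounded below; the lower bound on `w` grows
  -- with `r`, which leaves finitely many `r` for each `q`.
  have hS0 : ∀ r q,
      (Mir.intNu^[r] (PowerSeries.coeff r (Mir.bracket (Mir.dNu y)⁻¹))).coeff q ≠ 0 →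
      ∃ w : ℕ, (Mir.tangency f + 1) * r ≤ w ∧
        q = ((w : ℚ) - Mir.tangency f) / (Mir.tangency f + 1) := by
    intro r q h
    rw [hS] at h
    exact Mir.lam_ne_zero ((Mir.wtGE_X_pow _ r).mul
      (Mir.slopeLE_diag_mul_expTail f _).wtGE) h
  refine ⟨inv_ne_zero (Mir.nir_ne_zero hf hω), ?_, ?_⟩
  · intro r q hq
    rw [Mir.coeff_bracket hf hy0 hy] at hq
    by_contra hlt
    -- The evaluated factor has exponents `≥ 0` and `∂_ν g*` has exponents `≥ 1/(κ+1) - 1 > -1`.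
    refine hq ((Mir.ordGE_heval hy0 (by positivity) hyo _).mul hyo.dNu q ?_)
    have : 0 < 1 / ((Mir.tangency f : ℚ) + 1) := by positivity
    linarith
  · refine ⟨⟨fun r => Mir.intNu^[r] (PowerSeries.coeff r (Mir.bracket (Mir.dNu y)⁻¹)), ?_, ?_⟩,
      fun r => rfl, ?_⟩
    · have hmono : Monotone fun w : ℕ =>
          ((w : ℚ) - Mir.tangency f) / (Mir.tangency f + 1) := by
        intro a b hab
        have : (a : ℚ) ≤ b := by exact_mod_cast hab
        simp only
        gcongr
      refine ((Set.IsWF.of_wellFoundedLT (Set.univ : Set ℕ)).isPWO.image_of_monotone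
        hmono).mono ?_
      intro q hq
      obtain ⟨r, hr⟩ := Set.mem_iUnion.1 hq
      obtain ⟨w, _, hw⟩ := hS0 r q hr
      exact ⟨w, Set.mem_univ _, hw.symm⟩
    · intro q
      obtain ⟨M, hM⟩ := exists_nat_ge (q * ((Mir.tangency f : ℚ) + 1) + Mir.tangency f)
      refine (Set.finite_Iic M).subset fun r hr => ?_
      obtain ⟨w, hw, hqw⟩ := hS0 r q hr
      have h1 : (w : ℚ) = q * (Mir.tangency f + 1) + Mir.tangency f := by
        rw [hqw]; field_simp; ring
      rw [← h1] at hM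
      have h2 : w ≤ M := by exact_mod_cast hM
      rw [Set.mem_Iic]
      nlinarith
    · rw [one_div, inv_inv]
      ext q
      rw [Mir.coeff_nir, Mir.expSharp_neg_fUp, Mir.lam_diag_mul_expTail,
        HahnSeries.SummableFamily.coeff_hsum]
      exact finsum_congr fun r => (hS r q).symm
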